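/- Let $\mathbb T=\mathbb R/\mathbb Z$ with normalized Lebesgue measure, let $C(\mathbb T)$ be the space of continuous complex-valued functions on $\mathbb T$ with the supremum norm $\|\cdot\|_\infty$, let $L_p=L_p(\mathbb T)$, and let $S_\infty$ be the group of all bijections $\sigma:\mathbb Z\to\mathbb Z$. For $f\in L_1$ put $\widehat f(n)=\int_{\mathbb T}f(t)e^{-2\pi i n t}\,dt$ and, for $\sigma\in S_\infty$ and $N\in\mathbb N$, \[S_{\sigma,N}[f](t)=\sum_{|n|\le N}\widehat f(\sigma(n))\,e^{2\pi i\sigma(n)t}.\] For $h\in L_\infty$ let $M_h\in\mathcal B(L_2)$ be the multiplication operator $M_hg=hg$. A trigonometric polynomial is a finite complex linear combination of the functions $t\mapsto e^{2\pi i n t}$, $n\in\mathbb Z$, and $\langle h,g\rangle=\int_{\mathbb T}h(t)\overline{g(t)}\,dt$. The following are equivalent: (i) For every $f\in C(\mathbb T)$ there exists $\sigma\in S_\infty$ such that $\|S_{\sigma,N}[f]-f\|_\infty\to0$ as $N\to\infty$ (that is, Ulyanov's problem has a positive answer). (ii) For every $f\in C(\mathbb T)$ there exists $\sigma\in S_\infty$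 such that $M_{S_{\sigma,N}[f]}\to M_f$ in the strong operator topology on $\mathcal B(L_2)$. (iii) For every $f\in C(\mathbb T)$ there exists $\sigma\in S_\infty$ such that $M_{S_{\sigma,N}[f]}\to M_f$ in the weak operator topology on $\mathcal B(L_2)$. (iv) For every $f\in C(\mathbb T)$, $\displaystyle\inf_{\sigma\in S_\infty}\sup_N\|S_{\sigma,N}[f]\|_\infty<\infty$. (v) There exists a constant $C>0$ such that for every trigonometric polynomial $T$, $\displaystyle\inf_{\sigma\in S_\infty}\sup_N\|S_{\sigma,N}[T]\|_\infty\le C\|T\|_\infty$. (vi) There exist maps $C:L_2\to[0,\infty)$ and $\sigma:\{\text{trigonometric polynomials}\}\to S_\infty$ such that for every $g\in L_2$ and every trigonometric polynomial $T$, $\displaystyle\sup_N\|S_{\sigma(T),N}[T]\,g\|_2\le C(g)\|T\|_\infty$. (vii) There exist maps $C:L_1\to[0,\infty)$ and $\sigma:\{\text{trigonometric polynomials}\}\to S_\infty$ such that for every $g\in L_1$ and every trigonometric polynomial $T$, $\displaystyle\sup_N|\langle S_{\sigma(T),N}[T],g\rangle|\le C(g)\|T\|_\infty$. -/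

import Mathlib

open Filter Topology MeasureTheory
open scoped ENNReal NNReal ComplexConjugate

namespace RearrangedFourier

noncomputable section

/-- The circle `𝕋 = ℝ / ℤ`. -/
abbrev Torus : Type := UnitAddCircle

/-- The normalized Lebesgue (Haar) probability measure on `𝕋`. -/
abbrev torusMeasure : Measure Torus := AddCircle.haarAddCircle

/-- The complex space `L_p(𝕋)`. -/
abbrev LpTorus (p : ℝ≥0∞) : Type := Lp ℂ p torusMeasure

/-- The rearranged symmetric partial sum
`S_{σ,N}[f](t) = ∑_{|n| ≤ N} f̂(σ(n)) e^{2πi σ(n) t}`, as a continuous function on `𝕋`. -/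
def partialSum (σ : Equiv.Perm ℤ) (N : ℕ) (f : Torus → ℂ) : C(Torus, ℂ) :=
  ∑ n ∈ Finset.Icc (-(N : ℤ)) (N : ℤ), fourierCoeff f (σ n) • fourier (σ n)

/-- The multiplication operator `M_h : L₂(𝕋) → L₂(𝕋)`, `g ↦ h g`, for `h ∈ L_∞(𝕋)`. -/
def mulOp (h : LpTorus ∞) : LpTorus 2 →L[ℂ] LpTorus 2 :=
  (ContinuousLinearMap.mul ℂ ℂ).holderL torusMeasure ∞ 2 2 h

/-- The multiplication operator on `L₂(𝕋)` of a continuous function. -/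
def mulOpC (f : C(Torus, ℂ)) : LpTorus 2 →L[ℂ] LpTorus 2 :=
  mulOp (ContinuousMap.toLp ∞ torusMeasure ℂ f)

/-- Convergence `A N → B` in the strong operator topology of `B(L₂(𝕋))`. -/
def TendstoSOT (A : ℕ → LpTorus 2 →L[ℂ] LpTorus 2) (B : LpTorus 2 →L[ℂ] LpTorus 2) : Prop :=
  Tendsto
    (fun N => ContinuousLinearMap.toPointwiseConvergenceCLM ℂ (RingHom.id ℂ) _ _ (A N)) atTop
    (𝓝 (ContinuousLinearMap.toPointwiseConvergenceCLM ℂ (RingHom.id ℂ) _ _ B))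

/-- Convergence `A N → B` in the weak operator topology of `B(L₂(𝕋))`. -/
def TendstoWOT (A : ℕ → LpTorus 2 →L[ℂ] LpTorus 2) (B : LpTorus 2 →L[ℂ] LpTorus 2) : Prop :=
  Tendsto (fun N => ContinuousLinearMapWOT.ofCLM (A N)) atTop
    (𝓝 (ContinuousLinearMapWOT.ofCLM B))

/-- The space of trigonometric polynomials: finite linear combinations of the exponentials
`t ↦ e^{2πi n t}`, `n ∈ ℤ`. -/
def trigPoly : Submodule ℂ C(Torus, ℂ) :=
  Submodule.span ℂ (Set.range fun n : ℤ => (fourier n : C(Torus, ℂ)))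

/-- The pairing `⟨h, g⟩ = ∫ h(t) conj (g(t)) dt` of a continuous function with `g ∈ L₁(𝕋)`. -/
def pairing (h : C(Torus, ℂ)) (g : LpTorus 1) : ℂ :=
  ∫ t, h t * conj (g t) ∂torusMeasure

end

end RearrangedFourier

/-! All conditions are compared with (v), a bound for polynomials with one common constant.

The chain (i) → (ii) → (iii) → (iv) is soft: `M_h` has operator norm `‖h‖_∞`, and a weakly
convergent sequence of operators is bounded by Banach–Steinhaus. The same principle makes the bounds
in (vi) and (vii), given only pointwise in `g`, uniform in `g`, because the rearrangement there does
not depend on `g`; so each is equivalent to (v).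

(iv) → (v) is a gliding hump (`exists_uniform_bound_of_pointwise`). Polynomials violating the bound
with constant `4 ^ k` are normalized, damped by `2 ^ (-k)`, moved to disjoint frequency bands and
summed. A de la Vallée-Poussin filter, of norm at most 2 on `C(𝕋)`, cuts out one band and keeps the
order of the terms, so a rearrangement bounded for the sum would serve every block too well.

(v) → (i) rests on finite sets `A k` increasing to `ℤ` whose sub-sums of the Fourier series converge
uniformly to `f` (`exists_spectralSum_near`). De la Vallée-Poussin means converge, but their weights
are fractional for `n < |m| ≤ 3n`. Randomized rounding of these weights to 0 or 1 costs about the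
square root of (energy of the band) · `log n`. The energies of the bands `n = 3 ^ j` are summable,
so infinitely often they are far below `1 / j`, that is, `1 / log n`. The blocks between consecutive
`A k` then have small norm; (v) orders each block, and `exists_concatenation` joins the orders. -/

namespace RearrangedFourier

noncomputable section

/-! ### Fourier coefficients of continuous functions -/

lemma integrable_continuousMap (f : C(Torus, ℂ)) : Integrable f torusMeasure :=
  f.continuous.integrable_of_hasCompactSupport (HasCompactSupport.of_compactSpace _)

lemma norm_fourier_apply (n : ℤ) (t : Torus) : ‖(fourier n : C(Torus, ℂ)) t‖ = 1 :=
  Circle.norm_coe _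

lemma fourier_sub_apply {T : ℝ} (m : ℤ) (t s : AddCircle T) :
    fourier m (t - s) = fourier m t * fourier (-m) s := by
  have h : m • (t - s) = m • t + (-m) • s :=
    (zsmul_sub t s m).trans ((sub_eq_add_neg _ _).trans (congrArg _ (neg_zsmul s m).symm))
  rw [fourier_apply, fourier_apply, fourier_apply, h, AddCircle.toCircle_add, Circle.coe_mul]

/-! Scalar multiplication laws restated for the instance found on `C(𝕋)`. -/

lemma continuousMap_add_smul (a b : ℂ) (f : C(Torus, ℂ)) : (a + b) • f = a • f + b • f :=
  add_smul a b f

lemma continuousMap_zero_smul (f : C(Torus, ℂ)) : (0 : ℂ) • f = 0 := zero_smul ℂ f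

lemma continuousMap_smul_smul (a b : ℂ) (f : C(Torus, ℂ)) : a • b • f = (a * b) • f :=
  smul_smul a b f

lemma continuousMap_smul_sum {ι : Type*} (a : ℂ) (s : Finset ι) (f : ι → C(Torus, ℂ)) :
    a • ∑ i ∈ s, f i = ∑ i ∈ s, a • f i := Finset.smul_sum

lemma continuousMap_norm_smul (a : ℂ) (f : C(Torus, ℂ)) : ‖a • f‖ = ‖a‖ * ‖f‖ := norm_smul a f

lemma norm_fourierCoeff_le (f : C(Torus, ℂ)) (n : ℤ) : ‖fourierCoeff f n‖ ≤ ‖f‖ := by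
  refine (norm_integral_le_of_norm_le_const (C := ‖f‖) (.of_forall fun t => ?_)).trans ?_
  · rw [norm_smul, norm_fourier_apply, one_mul]
    exact f.norm_coe_le_norm t
  · simp

lemma fourierCoeff_add_apply (f g : C(Torus, ℂ)) (n : ℤ) :
    fourierCoeff (f + g : C(Torus, ℂ)) n = fourierCoeff f n + fourierCoeff g n := by
  rw [ContinuousMap.coe_add, fourierCoeff.add (integrable_continuousMap f)
    (integrable_continuousMap g)]
  rfl

lemma fourierCoeff_smul_apply (c : ℂ) (f : C(Torus, ℂ)) (n : ℤ) :
    fourierCoeff (c • f : C(Torus, ℂ)) n = c * fourierCoeff f n := by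
  rw [ContinuousMap.coe_smul]
  exact fourierCoeff.const_smul _ _ _

/-- The `n`-th Fourier coefficient as a continuous linear functional on `C(𝕋)`. -/
def fourierCoeffCLM (n : ℤ) : C(Torus, ℂ) →L[ℂ] ℂ :=
  LinearMap.mkContinuous
    { toFun := fun f => fourierCoeff f n
      map_add' := fun f g => fourierCoeff_add_apply f g n
      map_smul' := fun c f => fourierCoeff_smul_apply c f n } 1
    (fun f => by simpa using norm_fourierCoeff_le f n)

@[simp] lemma fourierCoeffCLM_apply (n : ℤ) (f : C(Torus, ℂ)) :
    fourierCoeffCLM n f = fourierCoeff f n := rfl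

lemma fourierCoeff_fourier_apply (n m : ℤ) :
    fourierCoeff (fourier n : C(Torus, ℂ)) m = if m = n then 1 else 0 := by
  rw [fourierCoeff_fourier, Pi.single_apply]

lemma fourierCoeff_fourier_mul (n m : ℤ) (f : C(Torus, ℂ)) :
    fourierCoeff ((fourier n : C(Torus, ℂ)) * f : C(Torus, ℂ)) m = fourierCoeff f (m - n) := by
  refine integral_congr_ae (.of_forall fun t => ?_)
  have h : -(m - n) = -m + n := by ring
  simp only [ContinuousMap.coe_mul, Pi.mul_apply, smul_eq_mul, h, fourier_add]
  ring

lemma fourier_mul_fourier (n m : ℤ) :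
    (fourier n : C(Torus, ℂ)) * fourier m = fourier (n + m) := by
  ext t; simp

/-- The sum of the terms of the Fourier series of `f` with frequencies in `A`. -/
def spectralSum (A : Finset ℤ) (f : C(Torus, ℂ)) : C(Torus, ℂ) :=
  ∑ m ∈ A, fourierCoeff f m • fourier m

lemma partialSum_eq_spectralSum (σ : Equiv.Perm ℤ) (N : ℕ) (f : C(Torus, ℂ)) :
    partialSum σ N f
      = spectralSum ((Finset.Icc (-(N : ℤ)) N).map σ.toEmbedding) f := by
  simp [partialSum, spectralSum]

lemma fourierCoeff_spectralSum (A : Finset ℤ) (f : C(Torus, ℂ)) (m : ℤ) :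
    fourierCoeff (spectralSum A f) m = if m ∈ A then fourierCoeff f m else 0 := by
  rw [← fourierCoeffCLM_apply, spectralSum, map_sum]
  simp [fourierCoeff_fourier_apply]

lemma spectralSum_mem_trigPoly (A : Finset ℤ) (f : C(Torus, ℂ)) :
    spectralSum A f ∈ trigPoly :=
  Submodule.sum_mem _ fun m _ => Submodule.smul_mem _ _ (Submodule.subset_span ⟨m, rfl⟩)

/-- Allowing every larger `A` lets the degrees of two summands be replaced by their maximum. -/
lemma exists_spectralSum_eq {T : C(Torus, ℂ)} (hT : T ∈ trigPoly) :
    ∃ d : ℕ, ∀ A : Finset ℤ, Finset.Icc (-(d : ℤ)) d ⊆ A → spectralSum A T = T := by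
  induction hT using Submodule.span_induction with
  | mem x h =>
    obtain ⟨n, rfl⟩ := h
    refine ⟨n.natAbs, fun A hA => ?_⟩
    have hn : n ∈ A := hA (by simp only [Finset.mem_Icc]; omega)
    simp [spectralSum, fourierCoeff_fourier_apply, continuousMap_zero_smul, ite_smul, hn]
  | zero =>
    refine ⟨0, fun A _ => Finset.sum_eq_zero fun m _ => ?_⟩
    rw [← fourierCoeffCLM_apply, map_zero, continuousMap_zero_smul]
  | add x y _ _ hx hy =>
    obtain ⟨d, hd⟩ := hx
    obtain ⟨e, he⟩ := hy
    refine ⟨max d e, fun A hA => ?_⟩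
    have h1 := hd A (subset_trans (Finset.Icc_subset_Icc (by simp) (by simp)) hA)
    have h2 := he A (subset_trans (Finset.Icc_subset_Icc (by simp) (by simp)) hA)
    conv_rhs => rw [← h1, ← h2]
    simp only [spectralSum, fourierCoeff_add_apply, continuousMap_add_smul, Finset.sum_add_distrib]
  | smul c x _ hx =>
    obtain ⟨d, hd⟩ := hx
    refine ⟨d, fun A hA => ?_⟩
    conv_rhs => rw [← hd A hA]
    simp only [spectralSum, fourierCoeff_smul_apply, ← continuousMap_smul_smul,
      continuousMap_smul_sum]

lemma exists_fourierCoeff_eq_zero {T : C(Torus, ℂ)} (hT : T ∈ trigPoly) :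
    ∃ d : ℕ, ∀ m : ℤ, m ∉ Finset.Icc (-(d : ℤ)) d → fourierCoeff T m = 0 := by
  obtain ⟨d, hd⟩ := exists_spectralSum_eq hT
  refine ⟨d, fun m hm => ?_⟩
  rw [← hd _ subset_rfl, fourierCoeff_spectralSum, if_neg hm]

/-! ### De la Vallée-Poussin means -/

/-- The trapezoidal weight equal to `1` on `[-n, n]` and vanishing off `[-3n, 3n]`. -/
def vpWeight (n : ℕ) (m : ℤ) : ℝ :=
  (((Finset.Icc (-(n : ℤ)) n).filter
    fun i => m - i ∈ Finset.Icc (-(2 * n : ℤ)) (2 * n)).card : ℝ) / (2 * n + 1)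

lemma card_Icc_neg (n : ℕ) : (Finset.Icc (-(n : ℤ)) n).card = 2 * n + 1 := by
  rw [Int.card_Icc]; omega

lemma vpWeight_nonneg (n : ℕ) (m : ℤ) : 0 ≤ vpWeight n m := by
  unfold vpWeight; positivity

lemma vpWeight_le_one (n : ℕ) (m : ℤ) : vpWeight n m ≤ 1 := by
  unfold vpWeight
  rw [div_le_one (by positivity)]
  have := Finset.card_filter_le (Finset.Icc (-(n : ℤ)) n)
    (fun i => m - i ∈ Finset.Icc (-(2 * n : ℤ)) (2 * n))
  rw [card_Icc_neg] at this
  exact_mod_cast this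

lemma vpWeight_eq_one {n : ℕ} {m : ℤ} (hm : m ∈ Finset.Icc (-(n : ℤ)) n) :
    vpWeight n m = 1 := by
  unfold vpWeight
  rw [Finset.filter_true_of_mem, card_Icc_neg]
  · push_cast; exact div_self (by positivity)
  · intro i hi
    simp only [Finset.mem_Icc] at *
    omega

lemma vpWeight_eq_zero {n : ℕ} {m : ℤ} (hm : m ∉ Finset.Icc (-(3 * n : ℤ)) (3 * n)) :
    vpWeight n m = 0 := by
  unfold vpWeight
  rw [Finset.filter_false_of_mem, Finset.card_empty]
  · simp
  · intro i hi
    simp only [Finset.mem_Icc] at *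
    omega

/-- The Dirichlet kernel. -/
def dirichlet (n : ℕ) : C(Torus, ℂ) := ∑ m ∈ Finset.Icc (-(n : ℤ)) n, fourier m

/-- The de la Vallée-Poussin kernel. -/
def vpKernel (n : ℕ) : C(Torus, ℂ) :=
  ∑ m ∈ Finset.Icc (-(3 * n : ℤ)) (3 * n), (vpWeight n m : ℂ) • fourier m

/-- A frequency `m` arises as `i + j` with `|i| ≤ n`, `|j| ≤ 2n` in exactly `(2n + 1) * vpWeight n
m` ways. -/
lemma vpKernel_eq (n : ℕ) :
    vpKernel n = ((2 * n + 1 : ℂ)⁻¹) • (dirichlet n * dirichlet (2 * n)) := by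
  have h : ∀ i ∈ Finset.Icc (-(n : ℤ)) n,
      ∑ j ∈ Finset.Icc (-(2 * n : ℤ)) (2 * n), (fourier (i + j) : C(Torus, ℂ))
        = ∑ m ∈ Finset.Icc (-(3 * n : ℤ)) (3 * n),
            if m - i ∈ Finset.Icc (-(2 * n : ℤ)) (2 * n) then fourier m else 0 := by
    intro i hi
    rw [← Finset.sum_filter]
    refine Finset.sum_bij (fun j _ => i + j) ?_ ?_ ?_ ?_
    · intro j hj
      simp only [Finset.mem_filter, Finset.mem_Icc] at *
      omega
    · intro j _ k _ h; simpa using h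
    · intro m hm
      simp only [Finset.mem_filter, Finset.mem_Icc] at *
      exact ⟨m - i, by omega, by ring⟩
    · intro j _; rfl
  have h2 : dirichlet n * dirichlet (2 * n)
      = ∑ m ∈ Finset.Icc (-(3 * n : ℤ)) (3 * n), ((2 * n + 1 : ℂ) * vpWeight n m) •
          (fourier m : C(Torus, ℂ)) := by
    simp only [dirichlet, Finset.sum_mul_sum, fourier_mul_fourier]
    push_cast
    rw [Finset.sum_congr rfl h, Finset.sum_comm]
    refine Finset.sum_congr rfl fun m _ => ?_
    rw [← Finset.sum_filter, Finset.sum_const, ← Nat.cast_smul_eq_nsmul ℂ]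
    congr 1
    have : (2 * n + 1 : ℂ) ≠ 0 := by exact_mod_cast (by omega : 2 * n + 1 ≠ 0)
    unfold vpWeight
    push_cast
    field_simp
  have : (2 * n + 1 : ℂ) ≠ 0 := by exact_mod_cast (by omega : 2 * n + 1 ≠ 0)
  rw [h2, continuousMap_smul_sum]
  refine Finset.sum_congr rfl fun m _ => ?_
  rw [continuousMap_smul_smul, inv_mul_cancel_left₀ this]

lemma integral_fourier (n : ℤ) :
    ∫ t, (fourier n : C(Torus, ℂ)) t ∂torusMeasure = if n = 0 then 1 else 0 := by
  have := fourierCoeff_fourier_apply n 0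
  simp only [fourierCoeff, neg_zero, fourier_zero, one_smul] at this
  rw [this]; simp [eq_comm]

lemma integral_norm_sq_dirichlet (n : ℕ) :
    ∫ t, ‖dirichlet n t‖ ^ 2 ∂torusMeasure = 2 * n + 1 := by
  have h : ∀ t, ((‖dirichlet n t‖ ^ 2 : ℝ) : ℂ)
      = ∑ i ∈ Finset.Icc (-(n : ℤ)) n, ∑ j ∈ Finset.Icc (-(n : ℤ)) n,
        (fourier (i - j) : C(Torus, ℂ)) t := by
    intro t
    rw [Complex.ofReal_pow, ← Complex.mul_conj']
    simp only [dirichlet, ContinuousMap.coe_sum, Finset.sum_apply, map_sum, Finset.sum_mul_sum,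
      sub_eq_add_neg, fourier_add, fourier_neg]
  have h2 : ((∫ t, ‖dirichlet n t‖ ^ 2 ∂torusMeasure : ℝ) : ℂ) = ((2 * n + 1 : ℝ) : ℂ) := by
    rw [← integral_complex_ofReal, integral_congr_ae (.of_forall h), integral_finsetSum]
    · rw [Finset.sum_congr rfl fun i _ =>
        integral_finsetSum _ fun j _ => integrable_continuousMap _]
      simp only [integral_fourier, sub_eq_zero]
      rw [Finset.sum_congr rfl (g := fun _ => (1 : ℂ))]
      · rw [Finset.sum_const, card_Icc_neg]; simp
      · intro i hi
        rw [Finset.sum_ite_eq, if_pos hi]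
    · exact fun i _ => integrable_finsetSum _ fun j _ => integrable_continuousMap _
  exact_mod_cast h2

lemma integrable_of_continuous {f : Torus → ℝ} (hf : Continuous f) :
    Integrable f torusMeasure :=
  hf.integrable_of_hasCompactSupport (HasCompactSupport.of_compactSpace _)

/-- By `|ab| ≤ (a² + b²) / 2` and the `L₂` norms of the two Dirichlet factors, the integral is at
most `(3n + 1) / (2n + 1)`. -/
lemma integral_norm_vpKernel_le (n : ℕ) :
    ∫ t, ‖vpKernel n t‖ ∂torusMeasure ≤ 2 := by
  have hpos : (0 : ℝ) < 2 * n + 1 := by positivity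
  have h : ∀ t, ‖vpKernel n t‖
      ≤ (2 * n + 1 : ℝ)⁻¹ * ((‖dirichlet n t‖ ^ 2 + ‖dirichlet (2 * n) t‖ ^ 2) / 2) := by
    intro t
    have h1 : ‖(2 * n + 1 : ℂ)‖ = 2 * n + 1 := by
      rw [show (2 * n + 1 : ℂ) = ((2 * n + 1 : ℝ) : ℂ) by push_cast; ring, Complex.norm_real,
        Real.norm_of_nonneg hpos.le]
    rw [vpKernel_eq]
    simp only [ContinuousMap.coe_smul, ContinuousMap.coe_mul, Pi.smul_apply, Pi.mul_apply,
      smul_eq_mul, norm_mul, norm_inv, h1]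
    gcongr
    nlinarith [sq_nonneg (‖dirichlet n t‖ - ‖dirichlet (2 * n) t‖)]
  calc ∫ t, ‖vpKernel n t‖ ∂torusMeasure
      ≤ ∫ t, (2 * n + 1 : ℝ)⁻¹ * ((‖dirichlet n t‖ ^ 2 + ‖dirichlet (2 * n) t‖ ^ 2) / 2)
          ∂torusMeasure :=
        integral_mono (integrable_of_continuous (by fun_prop))
          (integrable_of_continuous (by fun_prop)) h
    _ = (2 * n + 1 : ℝ)⁻¹ * (((2 * n + 1) + (2 * (2 * n) + 1)) / 2) := by
        rw [integral_const_mul, integral_div, integral_add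
          (integrable_of_continuous (by fun_prop)) (integrable_of_continuous (by fun_prop)),
          integral_norm_sq_dirichlet, integral_norm_sq_dirichlet]
        push_cast; ring
    _ ≤ 2 := by
        rw [inv_mul_le_iff₀ hpos]
        have : (0 : ℝ) ≤ n := by positivity
        linarith

/-- The de la Vallée-Poussin mean of `f`. -/
def vpMean (n : ℕ) (f : C(Torus, ℂ)) : C(Torus, ℂ) :=
  ∑ m ∈ Finset.Icc (-(3 * n : ℤ)) (3 * n), ((vpWeight n m : ℂ) * fourierCoeff f m) • fourier m

lemma vpMean_add (n : ℕ) (f g : C(Torus, ℂ)) : vpMean n (f + g) = vpMean n f + vpMean n g := by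
  simp only [vpMean, fourierCoeff_add_apply, mul_add, continuousMap_add_smul, Finset.sum_add_distrib]

lemma vpMean_smul (n : ℕ) (c : ℂ) (f : C(Torus, ℂ)) : vpMean n (c • f) = c • vpMean n f := by
  simp only [vpMean, fourierCoeff_smul_apply, continuousMap_smul_sum,
    continuousMap_smul_smul]
  exact Finset.sum_congr rfl fun m _ => by ring_nf

lemma vpMean_apply (n : ℕ) (f : C(Torus, ℂ)) (t : Torus) :
    vpMean n f t = ∫ s, f s * vpKernel n (t - s) ∂torusMeasure := by
  have h : ∀ m : ℤ, fourierCoeff f m * (fourier m : C(Torus, ℂ)) t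
      = ∫ s, f s * (fourier m : C(Torus, ℂ)) (t - s) ∂torusMeasure := by
    intro m
    rw [fourierCoeff, ← integral_mul_const]
    refine integral_congr_ae (.of_forall fun s => ?_)
    have : (fourier m : C(Torus, ℂ)) (t - s)
        = (fourier m : C(Torus, ℂ)) t * (fourier (-m) : C(Torus, ℂ)) s :=
      fourier_sub_apply m t s
    simp only [this, smul_eq_mul]
    ring
  simp only [vpMean, vpKernel, ContinuousMap.coe_sum, Finset.sum_apply, ContinuousMap.coe_smul,
    Pi.smul_apply, smul_eq_mul, Finset.mul_sum]
  rw [integral_finsetSum]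
  · refine Finset.sum_congr rfl fun m _ => ?_
    rw [mul_assoc, h, ← integral_const_mul]
    exact integral_congr_ae (.of_forall fun s => by ring)
  · intro m _
    exact Continuous.integrable_of_hasCompactSupport (by fun_prop)
      (HasCompactSupport.of_compactSpace _)

lemma norm_vpMean_le (n : ℕ) (f : C(Torus, ℂ)) : ‖vpMean n f‖ ≤ 2 * ‖f‖ := by
  rw [ContinuousMap.norm_le _ (by positivity)]
  intro t
  rw [vpMean_apply]
  calc ‖∫ s, f s * vpKernel n (t - s) ∂torusMeasure‖
      ≤ ∫ s, ‖f‖ * ‖vpKernel n (t - s)‖ ∂torusMeasure := by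
        refine norm_integral_le_of_norm_le (integrable_of_continuous (by fun_prop))
          (.of_forall fun s => ?_)
        rw [norm_mul]
        gcongr
        exact f.norm_coe_le_norm s
    _ = ‖f‖ * ∫ s, ‖vpKernel n s‖ ∂torusMeasure := by
        rw [integral_const_mul, integral_sub_left_eq_self (fun s => ‖vpKernel n s‖)]
    _ ≤ 2 * ‖f‖ := by
        rw [mul_comm]
        gcongr
        exact integral_norm_vpKernel_le n

/-- The operator `f ↦ vpMean n f` on `C(𝕋)`. -/
def vpCLM (n : ℕ) : C(Torus, ℂ) →L[ℂ] C(Torus, ℂ) :=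
  LinearMap.mkContinuous
    { toFun := vpMean n
      map_add' := vpMean_add n
      map_smul' := vpMean_smul n } 2 (norm_vpMean_le n)

@[simp] lemma vpCLM_apply (n : ℕ) (f : C(Torus, ℂ)) : vpCLM n f = vpMean n f := rfl

lemma vpMean_fourier (n : ℕ) (m : ℤ) :
    vpMean n (fourier m) = (vpWeight n m : ℂ) • fourier m := by
  simp only [vpMean, fourierCoeff_fourier_apply, mul_ite, mul_one, mul_zero, ite_smul,
    continuousMap_zero_smul]
  rw [Finset.sum_ite_eq']
  split_ifs with h
  · rfl
  · rw [vpWeight_eq_zero h, Complex.ofReal_zero, continuousMap_zero_smul]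

/-- The means are uniformly bounded by 2 and fix polynomials of degree at most `n`, which are dense
in the limit. -/
lemma tendsto_vpMean (f : C(Torus, ℂ)) : Tendsto (fun n => vpMean n f) atTop (𝓝 f) := by
  rw [Metric.tendsto_atTop]
  intro ε hε
  have hf : f ∈ closure (trigPoly : Set C(Torus, ℂ)) := by
    have := span_fourier_closure_eq_top (T := 1)
    rw [← Submodule.topologicalClosure_coe, trigPoly, this]
    trivial
  obtain ⟨P, hP, hfP⟩ := Metric.mem_closure_iff.1 hf (ε / 4) (by positivity)
  obtain ⟨d, hd⟩ := exists_fourierCoeff_eq_zero hP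
  obtain ⟨d', hd'⟩ := exists_spectralSum_eq hP
  refine ⟨max d d', fun n hn => ?_⟩
  have hn1 : d ≤ n := (le_max_left _ _).trans hn
  have hn2 : d' ≤ n := (le_max_right _ _).trans hn
  have hvP : vpMean n P = P := by
    conv_rhs => rw [← hd' (Finset.Icc (-(3 * n : ℤ)) (3 * n))
      (Finset.Icc_subset_Icc (by omega) (by omega))]
    refine Finset.sum_congr rfl fun m _ => ?_
    by_cases hm : m ∈ Finset.Icc (-(n : ℤ)) n
    · rw [vpWeight_eq_one hm]; simp
    · rw [hd m (fun h => hm (Finset.Icc_subset_Icc (by omega) (by omega) h))]; simp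
  have h1 : vpMean n f - f = vpMean n (f - P) - (f - P) := by
    rw [← vpCLM_apply, ← vpCLM_apply, map_sub, vpCLM_apply n P, hvP]; abel
  rw [dist_eq_norm, h1]
  rw [dist_eq_norm] at hfP
  have := norm_vpMean_le n (f - P)
  have := norm_sub_le (vpMean n (f - P)) (f - P)
  linarith

/-! ### Rounding Fourier multipliers to zero-one multipliers -/

lemma exp_le_add_exp_sq (x : ℝ) : Real.exp x ≤ x + Real.exp (x ^ 2) := by
  have h2 := Real.add_one_le_exp (x ^ 2)
  rcases le_or_gt |x| 1 with h | h
  · have := (abs_le.1 (Real.abs_exp_sub_one_sub_id_le h)).2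
    linarith
  · rcases lt_abs.1 h with h | h
    · have : Real.exp x ≤ Real.exp (x ^ 2) := Real.exp_le_exp.2 (by nlinarith)
      linarith
    · have : Real.exp x ≤ 1 := Real.exp_le_one_iff.2 (by linarith)
      nlinarith

/-- The variable is centred, so the linear terms of `exp_le_add_exp_sq` cancel on averaging. -/
lemma bernoulli_mgf_le {p : ℝ} (hp0 : 0 ≤ p) (hp1 : p ≤ 1) (x : ℝ) :
    p * Real.exp ((1 - p) * x) + (1 - p) * Real.exp ((0 - p) * x) ≤ Real.exp (x ^ 2) := by
  have h1 := exp_le_add_exp_sq ((1 - p) * x)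
  have h2 := exp_le_add_exp_sq ((0 - p) * x)
  have h3 : Real.exp (((1 - p) * x) ^ 2) ≤ Real.exp (x ^ 2) :=
    Real.exp_le_exp.2 (by rw [mul_pow]; exact mul_le_of_le_one_left (sq_nonneg x) (by nlinarith))
  have h4 : Real.exp (((0 - p) * x) ^ 2) ≤ Real.exp (x ^ 2) :=
    Real.exp_le_exp.2 (by rw [mul_pow]; exact mul_le_of_le_one_left (sq_nonneg x) (by nlinarith))
  have h5 := mul_le_mul_of_nonneg_left (h1.trans (add_le_add_right h3 _)) hp0
  have h6 := mul_le_mul_of_nonneg_left (h2.trans (add_le_add_right h4 _))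
    (sub_nonneg.2 hp1)
  nlinarith

/-- Derandomized rounding by the method of conditional expectations. -/
lemma exists_rounding_exp {ι I : Type*} [DecidableEq ι] (J : Finset I) (v : ι → ℝ)
    (hv0 : ∀ m, 0 ≤ v m) (hv1 : ∀ m, v m ≤ 1) (a : I → ι → ℝ) (B : Finset ι) :
    ∀ W : I → ℝ, (∀ i, 0 ≤ W i) → ∃ A ⊆ B,
      ∑ i ∈ J, W i * Real.exp (∑ m ∈ B, ((if m ∈ A then 1 else 0) - v m) * a i m)
        ≤ ∑ i ∈ J, W i * Real.exp (∑ m ∈ B, a i m ^ 2) := by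
  induction B using Finset.induction_on with
  | empty => exact fun W hW => ⟨∅, subset_rfl, by simp⟩
  | insert b B hb ih =>
    intro W hW
    -- The average over the random choice at `b` obeys the bound by `bernoulli_mgf_le`, so one of
    -- the two choices does.
    have hx : ∃ x : Bool,
        ∑ i ∈ J, W i * Real.exp (∑ m ∈ B, a i m ^ 2)
            * Real.exp (((if x then 1 else 0) - v b) * a i b)
          ≤ ∑ i ∈ J, W i * Real.exp (∑ m ∈ B, a i m ^ 2) * Real.exp (a i b ^ 2) := by
      by_contra! hcon
      have h1 := hcon true
      have h0 := hcon false
      simp only [if_true, Bool.false_eq_true, if_false] at h1 h0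
      set S := ∑ i ∈ J, W i * Real.exp (∑ m ∈ B, a i m ^ 2) * Real.exp (a i b ^ 2)
      set S1 := ∑ i ∈ J, W i * Real.exp (∑ m ∈ B, a i m ^ 2) * Real.exp ((1 - v b) * a i b)
      set S0 := ∑ i ∈ J, W i * Real.exp (∑ m ∈ B, a i m ^ 2) * Real.exp ((0 - v b) * a i b)
      have h : v b * S1 + (1 - v b) * S0 ≤ S := by
        rw [Finset.mul_sum, Finset.mul_sum, ← Finset.sum_add_distrib]
        refine Finset.sum_le_sum fun i _ => ?_
        have := mul_le_mul_of_nonneg_left (bernoulli_mgf_le (hv0 b) (hv1 b) (a i b))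
          (mul_nonneg (hW i) (Real.exp_pos (∑ m ∈ B, a i m ^ 2)).le)
        linarith
      rcases (hv0 b).eq_or_lt with hb0 | hb0
      · rw [← hb0] at h
        linarith
      · nlinarith [hv1 b]
    obtain ⟨x, hx⟩ := hx
    -- The factor of the decided coordinate is absorbed into the weights, which is why `W` is
    -- arbitrary.
    obtain ⟨A, hA, hAB⟩ := ih
      (fun i => W i * Real.exp (((if x then 1 else 0) - v b) * a i b))
      (fun i => mul_nonneg (hW i) (Real.exp_pos _).le)
    refine ⟨if x then insert b A else A, ?_, ?_⟩
    · split_ifs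
      · exact Finset.insert_subset_insert b hA
      · exact hA.trans (Finset.subset_insert b B)
    · have hbA : b ∉ A := fun h => hb (hA h)
      refine le_trans (le_of_eq ?_) (hAB.trans (le_of_eq_of_le ?_ (hx.trans (le_of_eq ?_))))
      · refine Finset.sum_congr rfl fun i _ => ?_
        rw [Finset.sum_insert hb, Real.exp_add, mul_assoc]
        congr 2
        · cases x <;> simp [hbA]
        · congr 1
          refine Finset.sum_congr rfl fun m hm => ?_
          have : m ≠ b := fun h => hb (h ▸ hm)
          cases x <;> simp [this]
      · exact Finset.sum_congr rfl fun i _ => by ring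
      · refine Finset.sum_congr rfl fun i _ => ?_
        rw [Finset.sum_insert hb, Real.exp_add]; ring

/-- The error made when the multiplier `v` on `B` is replaced by the indicator of `A`. -/
def roundingError (f : C(Torus, ℂ)) (v : ℤ → ℝ) (B A : Finset ℤ) : C(Torus, ℂ) :=
  ∑ m ∈ B, ((((if m ∈ A then 1 else 0) - v m : ℝ) : ℂ) * fourierCoeff f m) • fourier m

lemma roundingError_apply (f : C(Torus, ℂ)) (v : ℤ → ℝ) (B A : Finset ℤ) (t : Torus) :
    roundingError f v B A t = ∑ m ∈ B,
      ((((if m ∈ A then 1 else 0) - v m : ℝ) : ℂ) * fourierCoeff f m) *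
        (fourier m : C(Torus, ℂ)) t := by
  simp [roundingError]

lemma exists_rounding_real {ι I : Type*} [DecidableEq ι] (J : Finset I) (v : ι → ℝ)
    (hv0 : ∀ m, 0 ≤ v m) (hv1 : ∀ m, v m ≤ 1) (c : I → ι → ℝ) (w : ι → ℝ)
    (hc : ∀ i m, |c i m| ≤ w m) (B : Finset ι) {K : ℝ} (hK : 1 < K) (hJ : (J.card : ℝ) ≤ K)
    {ε : ℝ} (hε : 0 < ε) (hV : (∑ m ∈ B, w m ^ 2) * Real.log K ≤ ε ^ 2) :
    ∃ A ⊆ B, ∀ i ∈ J, ∑ m ∈ B, ((if m ∈ A then 1 else 0) - v m) * c i m ≤ 2 * ε := by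
  set V := ∑ m ∈ B, w m ^ 2 with hVdef
  set l := Real.log K with hl
  have hlpos : 0 < l := Real.log_pos hK
  -- This exponent gives `l = k * ε`, and the hypothesis `V * l ≤ ε ^ 2` then gives `k ^ 2 * V ≤ k *
  -- ε`.
  set k := l / ε with hk
  have hkpos : 0 < k := by positivity
  obtain ⟨A, hA, hexp⟩ := exists_rounding_exp J v hv0 hv1 (fun i m => k * c i m) B
    (fun _ => 1) (fun _ => zero_le_one)
  refine ⟨A, hA, fun i hi => ?_⟩
  set F : I → ℝ := fun i => 1 * Real.exp (∑ m ∈ B, ((if m ∈ A then 1 else 0) - v m) * (k * c i m))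
  have hFi : F i = Real.exp (k * ∑ m ∈ B, ((if m ∈ A then 1 else 0) - v m) * c i m) := by
    simp only [F, one_mul, Finset.mul_sum]
    congr 1
    exact Finset.sum_congr rfl fun m _ => by ring
  set X := ∑ m ∈ B, ((if m ∈ A then 1 else 0) - v m) * c i m
  have h1 : Real.exp (k * X) ≤ K * Real.exp (k ^ 2 * V) := by
    calc Real.exp (k * X) = F i := hFi.symm
      _ ≤ ∑ i ∈ J, F i := Finset.single_le_sum (fun i _ => by positivity) hi
      _ ≤ _ := hexp
      _ ≤ ∑ i ∈ J, Real.exp (k ^ 2 * V) := by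
          refine Finset.sum_le_sum fun i hi => ?_
          rw [one_mul, hVdef, Finset.mul_sum]
          refine Real.exp_le_exp.2 (Finset.sum_le_sum fun m _ => ?_)
          rw [mul_pow]
          refine mul_le_mul_of_nonneg_left ?_ (sq_nonneg k)
          exact sq_le_sq' (abs_le.1 (hc i m)).1 (abs_le.1 (hc i m)).2
      _ ≤ K * Real.exp (k ^ 2 * V) := by
          rw [Finset.sum_const, nsmul_eq_mul]
          exact mul_le_mul_of_nonneg_right hJ (Real.exp_pos _).le
  have h2 : k * X ≤ l + k ^ 2 * V := by
    have := Real.log_le_log (Real.exp_pos _) h1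
    rwa [Real.log_exp, Real.log_mul (by linarith) (Real.exp_pos _).ne', Real.log_exp] at this
  have h3 : l + k ^ 2 * V ≤ k * (2 * ε) := by
    have e1 : l = k * ε := by rw [hk]; field_simp
    have e2 : k ^ 2 * V = k * (V * l) / ε := by rw [hk]; field_simp
    have e3 : k * (V * l) / ε ≤ k * ε := by
      rw [div_le_iff₀ hε]
      nlinarith
    linarith
  exact le_of_mul_le_mul_left (h2.trans h3) hkpos

/-- Real parts after multiplication by `1, -1, i, -i` control the modulus. This makes four
constraints per point, whence `log (4 * G)`, and `4 * ε` is the sum of the bounds for the real and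
imaginary parts. -/
lemma exists_rounding_complex {ι I : Type*} [DecidableEq ι] (s : Finset I) (v : ι → ℝ)
    (hv0 : ∀ m, 0 ≤ v m) (hv1 : ∀ m, v m ≤ 1) (c : I → ι → ℂ) (w : ι → ℝ)
    (hc : ∀ i m, ‖c i m‖ ≤ w m) (B : Finset ι) {G : ℕ} (hG : 1 ≤ G) (hs : s.card ≤ G)
    {ε : ℝ} (hε : 0 < ε) (hV : (∑ m ∈ B, w m ^ 2) * Real.log (4 * G) ≤ ε ^ 2) :
    ∃ A ⊆ B, ∀ i ∈ s,
      ‖∑ m ∈ B, (((if m ∈ A then 1 else 0) - v m : ℝ) : ℂ) * c i m‖ ≤ 4 * ε := by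
  have hG' : (1 : ℝ) ≤ G := by exact_mod_cast hG
  set z : Fin 4 → ℂ := ![1, -1, Complex.I, -Complex.I] with hz
  have hz1 : ∀ r, ‖z r‖ = 1 := by
    intro r
    fin_cases r <;> simp [hz]
  obtain ⟨A, hA, h⟩ := exists_rounding_real (s ×ˢ (Finset.univ : Finset (Fin 4))) v hv0 hv1
    (fun i m => (z i.2 * c i.1 m).re) w (fun i m => by
      refine (Complex.abs_re_le_norm _).trans ?_
      rw [norm_mul, hz1, one_mul]
      exact hc _ _) B (K := 4 * G) (by linarith) (by
      rw [Finset.card_product, Finset.card_univ, Fintype.card_fin, mul_comm (4 : ℝ)]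
      exact_mod_cast Nat.mul_le_mul_right 4 hs) hε hV
  refine ⟨A, hA, fun i hi => ?_⟩
  set P := ∑ m ∈ B, (((if m ∈ A then 1 else 0) - v m : ℝ) : ℂ) * c i m with hP
  have hbound : ∀ r, (z r * P).re ≤ 2 * ε := by
    intro r
    refine le_of_eq_of_le ?_ (h (i, r) (Finset.mk_mem_product hi (Finset.mem_univ r)))
    rw [hP, Finset.mul_sum, Complex.re_sum]
    refine Finset.sum_congr rfl fun m _ => ?_
    rw [mul_left_comm, Complex.re_ofReal_mul]
  have h0 := hbound 0
  have h1 := hbound 1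
  have h2 := hbound 2
  have h3 := hbound 3
  simp only [hz, Matrix.cons_val, one_mul, neg_mul, Complex.neg_re, Complex.I_mul_re]
    at h0 h1 h2 h3
  have hre : |P.re| ≤ 2 * ε := abs_le.2 ⟨by linarith, h0⟩
  have him : |P.im| ≤ 2 * ε := abs_le.2 ⟨by linarith, by linarith⟩
  linarith [Complex.norm_le_abs_re_add_abs_im P]

/-- Rounding with a small error on a finite set of points. -/
lemma exists_rounding_points (f : C(Torus, ℂ)) (v : ℤ → ℝ) (hv0 : ∀ m, 0 ≤ v m)
    (hv1 : ∀ m, v m ≤ 1) (B : Finset ℤ) (s : Finset Torus) {G : ℕ} (hG : 1 ≤ G)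
    (hs : s.card ≤ G) {ε : ℝ} (hε : 0 < ε)
    (hV : (∑ m ∈ B, ‖fourierCoeff f m‖ ^ 2) * Real.log (4 * G) ≤ ε ^ 2) :
    ∃ A ⊆ B, ∀ t ∈ s, ‖roundingError f v B A t‖ ≤ 4 * ε := by
  obtain ⟨A, hA, h⟩ := exists_rounding_complex s v hv0 hv1
    (fun t m => fourierCoeff f m * (fourier m : C(Torus, ℂ)) t) (fun m => ‖fourierCoeff f m‖)
    (fun t m => by rw [norm_mul, norm_fourier_apply, mul_one]) B hG hs hε hV
  refine ⟨A, hA, fun t ht => ?_⟩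
  rw [roundingError_apply]
  simpa only [mul_assoc] using h t ht

lemma norm_fourier_sub_le (m : ℤ) (x y : ℝ) :
    ‖(fourier m : C(Torus, ℂ)) (x : Torus) - (fourier m : C(Torus, ℂ)) (y : Torus)‖
      ≤ 2 * Real.pi * |(m : ℝ)| * |x - y| := by
  have h : (fourier m : C(Torus, ℂ)) (x : Torus) - (fourier m : C(Torus, ℂ)) (y : Torus)
      = (fourier m : C(Torus, ℂ)) (y : Torus) *
        (Complex.exp (Complex.I * ((2 * Real.pi * m * (x - y) : ℝ) : ℂ)) - 1) := by
    rw [fourier_coe_apply, fourier_coe_apply, mul_sub, ← Complex.exp_add, mul_one]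
    congr 2
    push_cast
    ring
  rw [h, norm_mul, norm_fourier_apply, one_mul]
  refine (Real.norm_exp_I_mul_ofReal_sub_one_le).trans (le_of_eq ?_)
  rw [Real.norm_eq_abs, abs_mul, abs_mul, abs_of_pos Real.two_pi_pos]

/-- Rounding with a small uniform error. -/
lemma exists_rounding (f : C(Torus, ℂ)) (v : ℤ → ℝ) (hv0 : ∀ m, 0 ≤ v m)
    (hv1 : ∀ m, v m ≤ 1) {n : ℕ} (hn : 1 ≤ n) {B : Finset ℤ}
    (hB : B ⊆ Finset.Icc (-(3 * n : ℤ)) (3 * n)) {ε : ℝ} (hε : 0 < ε)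
    (hV : (∑ m ∈ B, ‖fourierCoeff f m‖ ^ 2) * Real.log (4 * (n ^ 3 : ℕ)) ≤ ε ^ 2) :
    ∃ A ⊆ B, ‖roundingError f v B A‖ ≤ 4 * ε + 168 * ‖f‖ / n := by
  have hn' : (1 : ℝ) ≤ n := by exact_mod_cast hn
  have hn0 : (0 : ℝ) < n := by linarith
  -- A grid of `n ^ 3` points costs only a factor `O(log n)`. Between grid points, at most `7n`
  -- terms each vary by at most `24n‖f‖ / n ^ 3`, which totals `168‖f‖ / n`.
  obtain ⟨A, hA, hgrid⟩ := exists_rounding_points f v hv0 hv1 B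
    ((Finset.range (n ^ 3)).image fun j : ℕ => (((j : ℝ) / (n ^ 3 : ℕ) : ℝ) : Torus))
    (Nat.one_le_pow _ _ hn) (Finset.card_image_le.trans (by simp)) hε hV
  refine ⟨A, hA, ?_⟩
  rw [ContinuousMap.norm_le _ (by positivity)]
  intro t
  obtain ⟨x, ⟨hx0, hx1⟩, rfl⟩ := AddCircle.eq_coe_Ico t
  set G : ℕ := n ^ 3 with hG
  have hGpos : (0 : ℝ) < G := by rw [hG]; positivity
  set j := ⌊x * G⌋₊ with hj
  have hj1 : (j : ℝ) ≤ x * G := Nat.floor_le (by positivity)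
  have hj2 : x * G < j + 1 := Nat.lt_floor_add_one _
  have hjG : j < G := by
    have : (j : ℝ) < G := hj1.trans_lt (by nlinarith)
    exact_mod_cast this
  have hxy : |x - (j : ℝ) / G| ≤ 1 / G := by
    rw [abs_le]
    constructor
    · have : (j : ℝ) / G ≤ x := by rwa [div_le_iff₀ hGpos]
      have : (0 : ℝ) < 1 / G := by positivity
      linarith
    · rw [sub_le_iff_le_add, ← add_div, le_div_iff₀ hGpos]
      linarith
  have hd : ‖roundingError f v B A (x : Torus)
      - roundingError f v B A (((j : ℝ) / G : ℝ) : Torus)‖ ≤ 168 * ‖f‖ / n := by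
    rw [roundingError_apply, roundingError_apply, ← Finset.sum_sub_distrib]
    have hterm : ∀ m ∈ B, ‖((((if m ∈ A then 1 else 0) - v m : ℝ) : ℂ) * fourierCoeff f m) *
          (fourier m : C(Torus, ℂ)) (x : Torus)
        - ((((if m ∈ A then 1 else 0) - v m : ℝ) : ℂ) * fourierCoeff f m) *
          (fourier m : C(Torus, ℂ)) (((j : ℝ) / G : ℝ) : Torus)‖
        ≤ ‖f‖ * (2 * 4 * (3 * n) * (1 / G)) := by
      intro m hm
      rw [← mul_sub, norm_mul, norm_mul, Complex.norm_real]
      have h1 : ‖(if m ∈ A then 1 else 0) - v m‖ ≤ 1 := by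
        rw [Real.norm_eq_abs, abs_le]
        have := hv0 m
        have := hv1 m
        split_ifs <;> constructor <;> linarith
      have h2 := norm_fourierCoeff_le f m
      have hmabs : |(m : ℝ)| ≤ 3 * n := by
        have := Finset.mem_Icc.1 (hB hm)
        rw [abs_le]
        exact ⟨by exact_mod_cast this.1, by exact_mod_cast this.2⟩
      have h3 := norm_fourier_sub_le m x ((j : ℝ) / G)
      have h4 : 2 * Real.pi * |(m : ℝ)| * |x - (j : ℝ) / G| ≤ 2 * 4 * (3 * n) * (1 / G) := by
        gcongr
        exact Real.pi_le_four
      calc _ ≤ 1 * ‖f‖ * (2 * 4 * (3 * n) * (1 / G)) := by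
            gcongr
            exact h3.trans h4
        _ = _ := by ring
    refine (norm_sum_le_of_le B hterm).trans ?_
    rw [Finset.sum_const, nsmul_eq_mul]
    have hcard : (B.card : ℝ) ≤ 7 * n := by
      have := Finset.card_le_card hB
      rw [Int.card_Icc] at this
      have h7 : B.card ≤ 7 * n := by omega
      exact_mod_cast h7
    calc (B.card : ℝ) * (‖f‖ * (2 * 4 * (3 * n) * (1 / G)))
        ≤ 7 * n * (‖f‖ * (2 * 4 * (3 * n) * (1 / G))) := by gcongr
      _ = 168 * ‖f‖ / n := by
        rw [hG]; push_cast; field_simp; ring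
  have hg := hgrid (((j : ℝ) / G : ℝ) : Torus)
    (Finset.mem_image.2 ⟨j, Finset.mem_range.2 hjG, rfl⟩)
  have := norm_sub_norm_le (roundingError f v B A (x : Torus))
    (roundingError f v B A (((j : ℝ) / G : ℝ) : Torus))
  linarith

/-! ### Uniform approximation by sub-sums of the Fourier series -/

lemma exists_mul_succ_le_of_summable {u : ℕ → ℝ} (hu : Summable u)
    {δ : ℝ} (hδ : 0 < δ) (j₀ : ℕ) : ∃ j ≥ j₀, u j * (j + 1) ≤ δ := by
  by_contra! h
  -- Otherwise `u` dominates a multiple of the harmonic series from `j₀` on.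
  have h1 : Summable fun j : ℕ => δ * (1 / ((j + j₀ + 1 : ℕ) : ℝ)) := by
    refine Summable.of_nonneg_of_le (fun j => by positivity) (fun j => ?_)
      ((summable_nat_add_iff j₀).2 hu)
    have := h (j + j₀) (by omega)
    rw [mul_one_div, div_le_iff₀ (by positivity)]
    push_cast at this ⊢
    exact this.le
  rw [summable_mul_left_iff hδ.ne'] at h1
  exact Real.not_summable_one_div_natCast ((summable_nat_add_iff (j₀ + 1)).1 h1)

lemma summable_sq_fourierCoeff (f : C(Torus, ℂ)) :
    Summable fun m : ℤ => ‖fourierCoeff f m‖ ^ 2 := by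
  have := (hasSum_sq_fourierCoeff (ContinuousMap.toLp 2 torusMeasure ℂ f)).summable
  simpa only [fourierCoeff_toLp] using this

/-- Every continuous function is uniformly approximated by sub-sums of its Fourier series, over
spectra caught between two intervals. -/
lemma exists_spectralSum_near (f : C(Torus, ℂ)) {ε : ℝ} (hε : 0 < ε) (n₀ : ℕ) :
    ∃ A : Finset ℤ, Finset.Icc (-(n₀ : ℤ)) n₀ ⊆ A ∧ ‖spectralSum A f - f‖ ≤ ε := by
  -- Only on this band can the weight differ from both 0 and 1.
  set B : ℕ → Finset ℤ := fun n => Finset.Icc (-(3 * n : ℤ)) (3 * n) \ Finset.Icc (-(n : ℤ)) n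
    with hBdef
  set u : ℕ → ℝ := fun j => ∑ m ∈ B (3 ^ j), ‖fourierCoeff f m‖ ^ 2 with hu
  have husum : Summable u := by
    refine summable_of_sum_range_le (c := ∑' m : ℤ, ‖fourierCoeff f m‖ ^ 2)
      (fun j => Finset.sum_nonneg fun m _ => sq_nonneg _) (fun J => ?_)
    -- The bands for `n = 3 ^ j` are disjoint, so their energies telescope and Bessel's inequality
    -- bounds the sum.
    have h1 : ∀ j, u j = ∑ m ∈ Finset.Icc (-((3 ^ (j + 1) : ℕ) : ℤ)) ((3 ^ (j + 1) : ℕ) : ℤ),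
          ‖fourierCoeff f m‖ ^ 2
        - ∑ m ∈ Finset.Icc (-((3 ^ j : ℕ) : ℤ)) ((3 ^ j : ℕ) : ℤ), ‖fourierCoeff f m‖ ^ 2 := by
      intro j
      have h3 : ((3 ^ (j + 1) : ℕ) : ℤ) = 3 * ((3 ^ j : ℕ) : ℤ) := by push_cast; ring
      rw [h3, eq_sub_iff_add_eq]
      have : (0 : ℤ) ≤ ((3 ^ j : ℕ) : ℤ) := Int.natCast_nonneg _
      exact Finset.sum_sdiff (Finset.Icc_subset_Icc (by linarith) (by linarith))
    rw [Finset.sum_congr rfl fun j _ => h1 j, Finset.sum_range_sub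
      (fun j => ∑ m ∈ Finset.Icc (-((3 ^ j : ℕ) : ℤ)) ((3 ^ j : ℕ) : ℤ), ‖fourierCoeff f m‖ ^ 2)]
    refine (sub_le_self _ (Finset.sum_nonneg fun m _ => sq_nonneg _)).trans ?_
    exact (summable_sq_fourierCoeff f).sum_le_tsum _ fun m _ => sq_nonneg _
  have hvp := tendsto_iff_norm_sub_tendsto_zero.1 (tendsto_vpMean f)
  have hinv : Tendsto (fun n : ℕ => 168 * ‖f‖ / (n : ℝ)) atTop (𝓝 0) :=
    tendsto_const_div_atTop_nhds_zero_nat _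
  obtain ⟨n₁, hn₁⟩ := eventually_atTop.1 (
    (hvp.eventually_lt_const (show 0 < ε / 3 by positivity)).and (hinv.eventually_lt_const (show 0 < ε / 3 by positivity)))
  -- The rounding error `4 * δ = ε / 3` joins two errors below `ε / 3`: that of the mean and that of
  -- the grid.
  set δ := ε / 12 with hδ
  have hδpos : 0 < δ := by positivity
  obtain ⟨j, hj, huj⟩ := exists_mul_succ_le_of_summable husum
    (show 0 < δ ^ 2 / 6 by positivity) (max n₀ n₁)
  set n := 3 ^ j with hn
  have hjn : j < n := Nat.lt_pow_self (by norm_num)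
  have hn0 : n₀ ≤ n := (le_max_left _ _).trans (hj.le.trans hjn.le)
  have hn1 : n₁ ≤ n := (le_max_right _ _).trans (hj.le.trans hjn.le)
  have hlog : Real.log (4 * (n ^ 3 : ℕ)) ≤ 6 * (j + 1) := by
    have h4 : Real.log 4 ≤ 4 - 1 := Real.log_le_sub_one_of_pos (by norm_num)
    have h3 : Real.log 3 ≤ 3 - 1 := Real.log_le_sub_one_of_pos (by norm_num)
    rw [hn]
    push_cast
    rw [Real.log_mul (by norm_num) (by positivity), Real.log_pow, Real.log_pow]
    push_cast
    have hj0 : (0 : ℝ) ≤ j := by positivity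
    nlinarith
  obtain ⟨A, hA, hround⟩ := exists_rounding f (vpWeight n) (vpWeight_nonneg n)
    (vpWeight_le_one n) (n := n) (by omega) (B := B n) Finset.sdiff_subset hδpos (by
      calc u j * Real.log (4 * (n ^ 3 : ℕ)) ≤ u j * (6 * (j + 1)) :=
            mul_le_mul_of_nonneg_left hlog (Finset.sum_nonneg fun m _ => sq_nonneg _)
        _ ≤ δ ^ 2 := by linarith)
  have hdisj : Disjoint (Finset.Icc (-(n : ℤ)) n) A :=
    Finset.disjoint_of_subset_right hA Finset.disjoint_sdiff
  have hIA : Finset.Icc (-(n : ℤ)) n ∪ A ⊆ Finset.Icc (-(3 * n : ℤ)) (3 * n) :=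
    Finset.union_subset (Finset.Icc_subset_Icc (by omega) (by omega))
      (hA.trans Finset.sdiff_subset)
  refine ⟨Finset.Icc (-(n : ℤ)) n ∪ A,
    (Finset.Icc_subset_Icc (by omega) (by omega)).trans Finset.subset_union_left, ?_⟩
  have hdiff : spectralSum (Finset.Icc (-(n : ℤ)) n ∪ A) f
      = vpMean n f + roundingError f (vpWeight n) (B n) A := by
    have hsub : Finset.Icc (-(n : ℤ)) n ⊆ Finset.Icc (-(3 * n : ℤ)) (3 * n) :=
      Finset.Icc_subset_Icc (by omega) (by omega)
    have hA2 : spectralSum A f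
        = ∑ m ∈ B n, (((if m ∈ A then 1 else 0 : ℝ) : ℂ) * fourierCoeff f m) • fourier m := by
      rw [spectralSum, ← Finset.sum_subset hA]
      · exact Finset.sum_congr rfl fun m hm => by simp [hm]
      · intro m _ hm
        rw [if_neg hm, Complex.ofReal_zero, zero_mul, continuousMap_zero_smul]
    rw [vpMean, ← Finset.sum_sdiff hsub, roundingError, add_right_comm, ← Finset.sum_add_distrib]
    rw [spectralSum, Finset.sum_union hdisj, ← spectralSum, ← spectralSum, hA2, add_comm]
    congr 1
    · refine Finset.sum_congr rfl fun m _ => ?_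
      rw [← continuousMap_add_smul]
      congr 1
      push_cast
      ring
    · exact Finset.sum_congr rfl fun m hm => by rw [vpWeight_eq_one hm]; simp
  obtain ⟨hv, hr⟩ := hn₁ n hn1
  rw [hdiff, add_sub_right_comm]
  have := norm_add_le (vpMean n f - f) (roundingError f (vpWeight n) (B n) A)
  linarith

/-! ### From pointwise to uniform bounds by a lacunary construction -/

lemma continuousMap_enorm_zero : ‖(0 : C(Torus, ℂ))‖ₑ = 0 := by
  rw [← ofReal_norm, norm_zero, ENNReal.ofReal_zero]

lemma partialSum_zero (σ : Equiv.Perm ℤ) (N : ℕ) :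
    partialSum σ N (0 : C(Torus, ℂ)) = 0 :=
  Finset.sum_eq_zero fun m _ => by
    rw [← fourierCoeffCLM_apply, map_zero, continuousMap_zero_smul]

/-- Modulation and filtering act on each term separately, so the terms near frequency `n` survive in
the order given by `σ`. -/
lemma vpMean_fourier_mul_partialSum (d : ℕ) (n : ℤ) (σ : Equiv.Perm ℤ) (N : ℕ)
    (f : C(Torus, ℂ)) :
    vpMean d ((fourier (-n) : C(Torus, ℂ)) * partialSum σ N f)
      = ∑ i ∈ Finset.Icc (-(N : ℤ)) N,
          (fourierCoeff f (σ i) * (vpWeight d (σ i - n) : ℂ)) • fourier (σ i - n) := by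
  have h : (fourier (-n) : C(Torus, ℂ)) * partialSum σ N f
      = ∑ i ∈ Finset.Icc (-(N : ℤ)) N, fourierCoeff f (σ i) • fourier (σ i - n) := by
    rw [partialSum, Finset.mul_sum]
    refine Finset.sum_congr rfl fun i _ => ?_
    have : σ i - n = -n + σ i := by ring
    ext t
    simp only [this, ContinuousMap.coe_mul, ContinuousMap.coe_smul, Pi.mul_apply, Pi.smul_apply,
      smul_eq_mul, fourier_add]
    ring
  rw [h, ← vpCLM_apply, map_sum]
  refine Finset.sum_congr rfl fun i _ => ?_
  rw [vpCLM_apply, vpMean_smul, vpMean_fourier, continuousMap_smul_smul]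

lemma exists_uniform_bound_of_pointwise
    (h : ∀ f : C(Torus, ℂ), (⨅ σ : Equiv.Perm ℤ, ⨆ N : ℕ, ‖partialSum σ N f‖ₑ) < ∞) :
    ∃ C : ℝ≥0, 0 < C ∧ ∀ T ∈ trigPoly,
      (⨅ σ : Equiv.Perm ℤ, ⨆ N : ℕ, ‖partialSum σ N T‖ₑ) ≤ (C : ℝ≥0∞) * ‖T‖ₑ := by
  by_contra! hcon
  choose T hT hlarge using fun k : ℕ => hcon (4 ^ k) (by positivity)
  choose d hd using fun k => exists_fourierCoeff_eq_zero (hT k)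
  have hT0 : ∀ k, 0 < ‖T k‖ := by
    intro k
    rw [norm_pos_iff]
    intro h0
    have := hlarge k
    rw [h0] at this
    refine absurd this (not_lt.2 (iInf_le_of_le 1 (iSup_le fun N => ?_)))
    rw [partialSum_zero, continuousMap_enorm_zero]
    exact zero_le
  set c : ℕ → ℝ := fun k => (1 / 2) ^ k / ‖T k‖ with hc
  have hc0 : ∀ k, 0 < c k := fun k => by have := hT0 k; positivity
  -- The band of block `k` has `6 * d k + 1` frequencies centred at `n k`, just enough for the
  -- filter of order `d k`, which vanishes beyond `3 * d k`, to see no other block.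
  set D : ℕ → ℤ := fun k => ∑ i ∈ Finset.range k, (6 * (d i : ℤ) + 1) with hD
  have hDmono : Monotone D := monotone_nat_of_le_succ fun k => by
    simp only [hD, Finset.sum_range_succ]; omega
  have hDsucc : ∀ k, D (k + 1) = D k + (6 * (d k : ℤ) + 1) := fun k => by
    simp only [hD, Finset.sum_range_succ]
  set n : ℕ → ℤ := fun k => D k + 3 * d k with hn
  set F : ℕ → C(Torus, ℂ) := fun k => (c k : ℂ) • ((fourier (n k) : C(Torus, ℂ)) * T k) with hF
  have hFsum : Summable F := by
    refine Summable.of_norm_bounded (g := fun k => (1 / 2 : ℝ) ^ k) summable_geometric_two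
      fun k => ?_
    rw [hF, continuousMap_norm_smul, Complex.norm_real, Real.norm_of_nonneg (hc0 k).le]
    have h1 : ‖(fourier (n k) : C(Torus, ℂ)) * T k‖ ≤ ‖T k‖ := by
      refine (norm_mul_le _ _).trans ?_
      rw [fourier_norm, one_mul]
    calc c k * ‖(fourier (n k) : C(Torus, ℂ)) * T k‖ ≤ c k * ‖T k‖ :=
          mul_le_mul_of_nonneg_left h1 (hc0 k).le
      _ = (1 / 2) ^ k := by rw [hc]; have := (hT0 k).ne'; field_simp
  set f := ∑' k, F k with hf
  have hcoef : ∀ k, ∀ m ∈ Finset.Icc (-(3 * d k : ℤ)) (3 * d k),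
      fourierCoeff f (m + n k) = c k * fourierCoeff (T k) m := by
    intro k m hm
    have h1 := (fourierCoeffCLM (m + n k)).hasSum hFsum.hasSum
    have h2 : ∀ l, fourierCoeffCLM (m + n k) (F l)
        = c l * fourierCoeff (T l) (m + n k - n l) := by
      intro l
      rw [fourierCoeffCLM_apply, hF, fourierCoeff_smul_apply, fourierCoeff_fourier_mul]
    have h3 := hasSum_single (f := fun l => fourierCoeffCLM (m + n k) (F l)) k (fun l hl => by
      rw [h2, hd l, mul_zero]
      intro hml
      simp only [Finset.mem_Icc, hn] at hm hml
      have hk1 := hDsucc k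
      have hl1 := hDsucc l
      rcases lt_or_gt_of_ne hl with hlk | hlk
      · have := hDmono (Nat.succ_le_of_lt hlk)
        simp only [Nat.succ_eq_add_one] at this
        omega
      · have := hDmono (Nat.succ_le_of_lt hlk)
        simp only [Nat.succ_eq_add_one] at this
        omega)
    have h4 := h1.unique h3
    rw [h2, add_sub_cancel_right] at h4
    exact h4
  obtain ⟨σ, hσ⟩ := iInf_lt_iff.1 (h f)
  set M := (⨆ N : ℕ, ‖partialSum σ N f‖ₑ).toReal with hM
  have hSM : ∀ N, ‖partialSum σ N f‖ ≤ M := by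
    intro N
    rw [← toReal_enorm]
    exact ENNReal.toReal_mono hσ.ne (le_iSup (fun N => ‖partialSum σ N f‖ₑ) N)
  have hM0 : 0 ≤ M := ENNReal.toReal_nonneg
  have hkey : ∀ k : ℕ, (2 : ℝ) ^ k ≤ 2 * M := by
    intro k
    -- Recentring the band at 0 turns the order `σ` into a rearrangement for `T k` itself.
    set τ : Equiv.Perm ℤ := σ.trans (Equiv.subRight (n k)) with hτ
    have hvp : ∀ N, vpMean (d k) ((fourier (-(n k)) : C(Torus, ℂ)) * partialSum σ N f)
        = (c k : ℂ) • partialSum τ N (T k) := by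
      intro N
      rw [vpMean_fourier_mul_partialSum, partialSum, continuousMap_smul_sum]
      refine Finset.sum_congr rfl fun i _ => ?_
      have hτi : τ i = σ i - n k := rfl
      rw [continuousMap_smul_smul, hτi]
      congr 1
      set m := σ i - n k with hm
      have hσi : σ i = m + n k := by rw [hm]; ring
      rw [hσi]
      -- The filter is 1 on the spectrum of `T k`; elsewhere in the band the coefficient vanishes,
      -- and outside the band the weight does.
      by_cases hm3 : m ∈ Finset.Icc (-(3 * d k : ℤ)) (3 * d k)
      · rw [hcoef k m hm3]
        by_cases hm1 : m ∈ Finset.Icc (-(d k : ℤ)) (d k)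
        · rw [vpWeight_eq_one hm1]; simp
        · rw [hd k m hm1]; simp
      · rw [vpWeight_eq_zero hm3, hd k m]
        · simp
        · intro hm1
          exact hm3 (Finset.Icc_subset_Icc (by omega) (by omega) hm1)
    have hbd : ∀ N, ‖partialSum τ N (T k)‖ ≤ 2 * M * 2 ^ k * ‖T k‖ := by
      intro N
      have h1 : c k * ‖partialSum τ N (T k)‖ ≤ 2 * M := by
        calc c k * ‖partialSum τ N (T k)‖ = ‖(c k : ℂ) • partialSum τ N (T k)‖ := by
              rw [continuousMap_norm_smul, Complex.norm_real, Real.norm_of_nonneg (hc0 k).le]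
          _ ≤ 2 * ‖(fourier (-(n k)) : C(Torus, ℂ)) * partialSum σ N f‖ := by
              rw [← hvp]; exact norm_vpMean_le _ _
          _ ≤ 2 * (‖(fourier (-(n k)) : C(Torus, ℂ))‖ * ‖partialSum σ N f‖) := by
              gcongr; exact norm_mul_le _ _
          _ ≤ 2 * M := by rw [fourier_norm, one_mul]; linarith [hSM N]
      rw [mul_comm, ← le_div_iff₀ (hc0 k)] at h1
      refine h1.trans (le_of_eq ?_)
      rw [hc]
      have := (hT0 k).ne'
      simp only [one_div, inv_pow]
      field_simp
    have h2 : ((4 ^ k : ℝ≥0) : ℝ≥0∞) * ‖T k‖ₑ ≤ ENNReal.ofReal (2 * M * 2 ^ k * ‖T k‖) := by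
      refine (hlarge k).le.trans (iInf_le_of_le τ (iSup_le fun N => ?_))
      rw [← ofReal_norm]
      exact ENNReal.ofReal_le_ofReal (hbd N)
    have h3 : (4 : ℝ) ^ k * ‖T k‖ ≤ 2 * M * 2 ^ k * ‖T k‖ := by
      have := ENNReal.toReal_mono ENNReal.ofReal_ne_top h2
      rw [ENNReal.toReal_ofReal (by positivity), ENNReal.toReal_mul, toReal_enorm] at this
      simpa using this
    have h4 : (4 : ℝ) ^ k ≤ 2 * M * 2 ^ k := le_of_mul_le_mul_right h3 (hT0 k)
    rw [show (4 : ℝ) = 2 * 2 by norm_num, mul_pow] at h4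
    exact le_of_mul_le_mul_right h4 (by positivity)
  obtain ⟨k, hk⟩ := pow_unbounded_of_one_lt (2 * M) (one_lt_two (α := ℝ))
  exact absurd (hkey k) (not_le.2 hk)

/-! ### Concatenating rearrangements of blocks -/

/-- The first `r` frequencies of an enumeration of `ℤ`. -/
def freqPrefix (π : ℕ ≃ ℤ) (r : ℕ) : Finset ℤ := (Finset.range r).map π.toEmbedding

lemma mem_freqPrefix {π : ℕ ≃ ℤ} {r : ℕ} {m : ℤ} : m ∈ freqPrefix π r ↔ π.symm m < r := by
  simp only [freqPrefix, Finset.mem_map, Finset.mem_range, Equiv.coe_toEmbedding]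
  constructor
  · rintro ⟨i, hi, rfl⟩; simpa using hi
  · exact fun h => ⟨π.symm m, h, by simp⟩

lemma intEquivNat_lt_iff (i : ℤ) (N : ℕ) :
    Equiv.intEquivNat i < 2 * N + 1 ↔ i ∈ Finset.Icc (-(N : ℤ)) N := by
  rw [Finset.mem_Icc]
  cases i with
  | ofNat a =>
    have : Equiv.intEquivNat (Int.ofNat a) = 2 * a := rfl
    rw [this, Int.ofNat_eq_natCast]; omega
  | negSucc a =>
    have : Equiv.intEquivNat (Int.negSucc a) = 2 * a + 1 := rfl
    rw [this, Int.negSucc_eq]; omega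

/-- In the order `0, -1, 1, -2, 2, …` symmetric sums are the prefixes of odd length, so
rearrangements can be built as enumerations by `ℕ`. -/
lemma partialSum_eq_freqPrefix (σ : Equiv.Perm ℤ) (N : ℕ) (f : C(Torus, ℂ)) :
    partialSum σ N f
      = spectralSum (freqPrefix (Equiv.intEquivNat.symm.trans σ) (2 * N + 1)) f := by
  rw [partialSum_eq_spectralSum]
  congr 1
  ext m
  rw [mem_freqPrefix, Equiv.symm_trans_apply, Equiv.symm_symm, intEquivNat_lt_iff]
  simp only [Finset.mem_map, Equiv.coe_toEmbedding]
  constructor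
  · rintro ⟨i, hi, rfl⟩; simpa using hi
  · exact fun h => ⟨σ.symm m, h, by simp⟩

/-- The integers are listed by increasing key; the set of keys is an infinite subset of `ℕ`, hence
order isomorphic to `ℕ`. -/
lemma exists_enumeration_of_injective {K : ℤ → ℕ} (hK : Function.Injective K) :
    ∃ π : ℕ ≃ ℤ, StrictMono fun i => K (π i) := by
  classical
  have hinf : Infinite (Set.range K) := Set.infinite_range_of_injective hK |>.to_subtype
  refine ⟨(Nat.Subtype.orderIsoOfNat (Set.range K)).toEquiv.trans
    (Equiv.ofInjective K hK).symm, fun i j hij => ?_⟩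
  have h : ∀ i, K (((Nat.Subtype.orderIsoOfNat (Set.range K)).toEquiv.trans
      (Equiv.ofInjective K hK).symm) i) = Nat.Subtype.orderIsoOfNat (Set.range K) i :=
    fun i => Equiv.apply_ofInjective_symm hK _
  simp only [h]
  exact (Nat.Subtype.orderIsoOfNat (Set.range K)).strictMono hij

/-- Enumerate `ℤ` by running through the successive blocks `A (k + 1) \ A k`, the `k`-th one in
the order prescribed by `ρ k`. -/
lemma exists_concatenation (A : ℕ → Finset ℤ) (hA0 : A 0 = ∅) (hA : Monotone A)
    (hcov : ∀ m, ∃ k, m ∈ A (k + 1)) (ρ : ℕ → ℕ ≃ ℤ) :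
    ∃ π : ℕ ≃ ℤ, ∀ k₀, ∃ r₀, ∀ r ≥ r₀, ∃ k ≥ k₀, ∃ j,
      freqPrefix π r = A k ∪ (A (k + 1) \ A k) ∩ freqPrefix (ρ k) j := by
  classical
  set b : ℤ → ℕ := fun m => Nat.find (hcov m) with hb
  have hmem : ∀ m k, m ∈ A k ↔ b m < k := by
    intro m k
    constructor
    · intro h
      cases k with
      | zero => simp [hA0] at h
      | succ k => exact Nat.lt_succ_of_le (Nat.find_min' (hcov m) h)
    · exact fun h => hA (Nat.succ_le_of_lt h) (Nat.find_spec (hcov m))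
  -- The length exceeds every position in `ρ k` of an element of block `k`, so the keys `K` of that
  -- block lie in `[O k, O (k + 1))`.
  set l : ℕ → ℕ := fun k => (A (k + 1)).sup (fun m => (ρ k).symm m) + 1 with hl
  have hlt : ∀ m, (ρ (b m)).symm m < l (b m) := by
    intro m
    have hm : m ∈ A (b m + 1) := (hmem m _).2 (Nat.lt_succ_self _)
    exact Nat.lt_succ_of_le (Finset.le_sup (f := fun m' => (ρ (b m)).symm m') hm)
  set O : ℕ → ℕ := fun k => ∑ i ∈ Finset.range k, l i with hO
  have hOsucc : ∀ k, O (k + 1) = O k + l k := fun k => Finset.sum_range_succ _ _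
  have hOmono : StrictMono O := strictMono_nat_of_lt_succ fun k => by
    rw [hOsucc]; simp only [hl]; omega
  set K : ℤ → ℕ := fun m => O (b m) + (ρ (b m)).symm m with hKdef
  have hKlt : ∀ m, K m < O (b m + 1) := fun m => by
    rw [hOsucc]; exact Nat.add_lt_add_left (hlt m) _
  have hKge : ∀ m, O (b m) ≤ K m := fun m => Nat.le_add_right _ _
  have hKinj : Function.Injective K := by
    intro m m' h
    have hbb : b m = b m' := by
      by_contra hne
      rcases lt_or_gt_of_ne hne with h1 | h1
      · have := hOmono.monotone (Nat.succ_le_of_lt h1)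
        have h2 := hKlt m
        have h3 := hKge m'
        simp only [Nat.succ_eq_add_one] at this
        omega
      · have := hOmono.monotone (Nat.succ_le_of_lt h1)
        have h2 := hKlt m'
        have h3 := hKge m
        simp only [Nat.succ_eq_add_one] at this
        omega
    simp only [hKdef, hbb] at h
    exact (ρ (b m')).symm.injective (Nat.add_left_cancel h)
  obtain ⟨π, hπ⟩ := exists_enumeration_of_injective hKinj
  refine ⟨π, fun k₀ => ⟨O k₀, fun r hr => ?_⟩⟩
  -- The prefix of length `r` is `{m | K m < c}`: all blocks before the one whose key range contains
  -- `c`, and a prefix of that one.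
  set c := K (π r) with hc
  have hrc : r ≤ c := hπ.le_apply
  have hex : ∃ k, c < O (k + 1) := ⟨c, (Nat.lt_succ_self c).trans_le hOmono.le_apply⟩
  set k := Nat.find hex with hk
  have hk1 : c < O (k + 1) := Nat.find_spec hex
  have hk0 : O k ≤ c := by
    rcases Nat.eq_zero_or_pos k with h0 | h0
    · rw [h0]; simp [hO]
    · have := Nat.find_min hex (m := k - 1) (by omega)
      rw [Nat.sub_add_cancel h0] at this
      omega
  refine ⟨k, ?_, c - O k, ?_⟩
  · by_contra! h
    have := hOmono.monotone (Nat.succ_le_of_lt h)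
    simp only [Nat.succ_eq_add_one] at this
    omega
  · ext m
    have hm : m ∈ freqPrefix π r ↔ K m < c := by
      rw [mem_freqPrefix, hc, ← hπ.lt_iff_lt]
      simp
    rw [hm]
    simp only [Finset.mem_union, Finset.mem_inter, Finset.mem_sdiff, mem_freqPrefix, hmem]
    have h2 := hKlt m
    have h3 := hKge m
    rcases lt_trichotomy (b m) k with h | h | h
    · have := hOmono.monotone (Nat.succ_le_of_lt h)
      simp only [Nat.succ_eq_add_one] at this
      constructor
      · exact fun _ => Or.inl h
      · intro _; omega
    · have hKm : K m = O k + (ρ k).symm m := by simp only [hKdef, h]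
      rw [hKm]
      omega
    · have := hOmono.monotone (Nat.succ_le_of_lt h)
      simp only [Nat.succ_eq_add_one] at this
      constructor
      · intro h; omega
      · intro h; omega

lemma exists_spectral_exhaustion (f : C(Torus, ℂ)) :
    ∃ A : ℕ → Finset ℤ, A 0 = ∅ ∧ Monotone A ∧ (∀ m, ∃ k, m ∈ A (k + 1)) ∧
      Tendsto (fun k => ‖spectralSum (A k) f - f‖) atTop (𝓝 0) := by
  have hstep : ∀ (A : Finset ℤ) (k : ℕ), ∃ A' : Finset ℤ, A ⊆ A' ∧
      Finset.Icc (-(k : ℤ)) k ⊆ A' ∧ ‖spectralSum A' f - f‖ ≤ 1 / ((k : ℝ) + 1) := by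
    intro A k
    -- The prescribed interval swallows both the previous set and `[-k, k]`, which gives
    -- monotonicity and exhaustion.
    obtain ⟨A', hA', hn⟩ := exists_spectralSum_near f (ε := 1 / ((k : ℝ) + 1)) (by positivity)
      (max k (A.sup Int.natAbs))
    refine ⟨A', fun m hm => hA' ?_, fun m hm => hA' ?_, hn⟩
    · have : m.natAbs ≤ A.sup Int.natAbs := Finset.le_sup hm
      rw [Finset.mem_Icc]
      omega
    · rw [Finset.mem_Icc] at *
      omega
  choose next h1 h2 h3 using hstep
  refine ⟨fun k => Nat.rec ∅ (fun k A => next A k) k, rfl,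
    monotone_nat_of_le_succ fun k => h1 _ _, fun m => ⟨m.natAbs, h2 _ _ ?_⟩, ?_⟩
  · rw [Finset.mem_Icc]; omega
  · refine (tendsto_add_atTop_iff_nat 1).1 ?_
    exact squeeze_zero (fun k => norm_nonneg _) (fun k => h3 _ _)
      tendsto_one_div_add_atTop_nhds_zero_nat

lemma spectralSum_sub_of_subset {A A' : Finset ℤ} (h : A ⊆ A') (f : C(Torus, ℂ)) :
    spectralSum (A' \ A) f = spectralSum A' f - spectralSum A f :=
  eq_sub_of_add_eq (Finset.sum_sdiff h)

lemma spectralSum_spectralSum (A B : Finset ℤ) (f : C(Torus, ℂ)) :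
    spectralSum A (spectralSum B f) = spectralSum (B ∩ A) f := by
  rw [Finset.inter_comm, spectralSum, show spectralSum (A ∩ B) f
    = ∑ m ∈ A ∩ B, fourierCoeff f m • fourier m from rfl,
    ← Finset.filter_mem_eq_inter, Finset.sum_filter]
  refine Finset.sum_congr rfl fun m _ => ?_
  rw [fourierCoeff_spectralSum]
  split_ifs
  · rfl
  · exact continuousMap_zero_smul _

/-- If every trigonometric polynomial `T` has a rearrangement with partial sums bounded by
`K * ‖T‖`, then every continuous function has a uniformly convergent rearrangement. -/
lemma exists_tendsto_partialSum {K : ℝ} (hK0 : 0 ≤ K)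
    (hK : ∀ T ∈ trigPoly, ∃ τ : Equiv.Perm ℤ, ∀ N, ‖partialSum τ N T‖ ≤ K * ‖T‖)
    (f : C(Torus, ℂ)) :
    ∃ σ : Equiv.Perm ℤ, Tendsto (fun N => ‖partialSum σ N f - f‖) atTop (𝓝 0) := by
  obtain ⟨A, hA0, hA, hcov, hlim⟩ := exists_spectral_exhaustion f
  choose τ hτ using fun k => hK (spectralSum (A (k + 1) \ A k) f) (spectralSum_mem_trigPoly _ _)
  obtain ⟨π, hπ⟩ := exists_concatenation A hA0 hA hcov
    (fun k => Equiv.intEquivNat.symm.trans (τ k))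
  set η : ℕ → ℝ := fun k => ‖spectralSum (A k) f - f‖ +
    (K + 1) * (‖spectralSum (A (k + 1)) f - f‖ + ‖spectralSum (A k) f - f‖) with hη
  have hηlim : Tendsto η atTop (𝓝 0) := by
    have := hlim.add (((hlim.comp (tendsto_add_atTop_nat 1)).add hlim).const_mul (K + 1))
    simpa using this
  have hprefix : ∀ k j, ‖spectralSum ((A (k + 1) \ A k) ∩
      freqPrefix (Equiv.intEquivNat.symm.trans (τ k)) j) f‖
        ≤ (K + 1) * (‖spectralSum (A (k + 1)) f - f‖ + ‖spectralSum (A k) f - f‖) := by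
    intro k j
    set T := spectralSum (A (k + 1) \ A k) f with hT
    have hTn : ‖T‖ ≤ ‖spectralSum (A (k + 1)) f - f‖ + ‖spectralSum (A k) f - f‖ := by
      rw [hT, spectralSum_sub_of_subset (hA (Nat.le_succ k)),
        ← sub_sub_sub_cancel_right _ _ f]
      exact norm_sub_le _ _
    rw [← spectralSum_spectralSum, ← hT]
    refine le_trans ?_ (mul_le_mul_of_nonneg_left hTn (by linarith))
    have hT0 := norm_nonneg T
    -- Odd prefixes are symmetric partial sums. A nonempty even one has one further term, of norm at
    -- most `‖T‖`; hence `K + 1`.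
    rcases j.even_or_odd' with ⟨N, rfl | rfl⟩
    · cases N with
      | zero =>
        have : spectralSum (freqPrefix (Equiv.intEquivNat.symm.trans (τ k)) (2 * 0)) T = 0 := rfl
        rw [this, norm_zero]
        positivity
      | succ N =>
        have h1 : spectralSum (freqPrefix (Equiv.intEquivNat.symm.trans (τ k)) (2 * (N + 1))) T
            = partialSum (τ k) N T + fourierCoeff T
                ((Equiv.intEquivNat.symm.trans (τ k)) (2 * N + 1)) •
                fourier ((Equiv.intEquivNat.symm.trans (τ k)) (2 * N + 1)) := by
          rw [partialSum_eq_freqPrefix, spectralSum, spectralSum, freqPrefix, freqPrefix,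
            Finset.sum_map, Finset.sum_map]
          exact Finset.sum_range_succ _ _
        rw [h1]
        refine (norm_add_le _ _).trans ?_
        rw [continuousMap_norm_smul, fourier_norm, mul_one]
        have := hτ k N
        have := norm_fourierCoeff_le T ((Equiv.intEquivNat.symm.trans (τ k)) (2 * N + 1))
        linarith
    · rw [← partialSum_eq_freqPrefix]
      have := hτ k N
      linarith
  refine ⟨Equiv.intEquivNat.trans π, ?_⟩
  rw [Metric.tendsto_atTop]
  intro ε hε
  obtain ⟨k₀, hk₀⟩ := eventually_atTop.1 (hηlim.eventually_lt_const hε)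
  obtain ⟨r₀, hr₀⟩ := hπ k₀
  refine ⟨r₀, fun N hN => ?_⟩
  obtain ⟨k, hk, j, hkj⟩ := hr₀ (2 * N + 1) (by omega)
  have hπ' : Equiv.intEquivNat.symm.trans (Equiv.intEquivNat.trans π) = π := by ext; simp
  rw [dist_zero_right, norm_norm, partialSum_eq_freqPrefix, hπ', hkj]
  refine lt_of_le_of_lt ?_ (hk₀ k hk)
  have hdisj : Disjoint (A k) ((A (k + 1) \ A k) ∩
      freqPrefix (Equiv.intEquivNat.symm.trans (τ k)) j) :=
    Finset.disjoint_of_subset_right Finset.inter_subset_left Finset.disjoint_sdiff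
  have hsum : spectralSum (A k ∪ (A (k + 1) \ A k) ∩
        freqPrefix (Equiv.intEquivNat.symm.trans (τ k)) j) f
      = spectralSum (A k) f + spectralSum ((A (k + 1) \ A k) ∩
        freqPrefix (Equiv.intEquivNat.symm.trans (τ k)) j) f := Finset.sum_union hdisj
  rw [hsum, add_sub_right_comm]
  exact (norm_add_le _ _).trans (by simp only [hη]; linarith [hprefix k j])

/-! ### Multiplication operators and the pairing with `L₁` -/

lemma enorm_le_coe_mul_enorm_iff {E F : Type*} [SeminormedAddGroup E] [SeminormedAddGroup F]
    {a : E} {b : F} {C : ℝ≥0} : ‖a‖ₑ ≤ (C : ℝ≥0∞) * ‖b‖ₑ ↔ ‖a‖ ≤ C * ‖b‖ := by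
  rw [enorm_eq_nnnorm, enorm_eq_nnnorm, ← ENNReal.coe_mul, ENNReal.coe_le_coe]
  exact Iff.rfl

lemma mulOpC_coeFn (h : C(Torus, ℂ)) (g : LpTorus 2) :
    mulOpC h g =ᵐ[torusMeasure] fun t => h t * g t := by
  have h1 := (ContinuousLinearMap.mul ℂ ℂ).coeFn_holder (r := 2)
    (ContinuousMap.toLp ∞ torusMeasure ℂ h) g
  filter_upwards [h1, ContinuousMap.coeFn_toLp (p := ∞) (𝕜 := ℂ) torusMeasure h] with t ht1 ht2
  rw [← ht2]
  exact ht1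

lemma norm_mulOpC_apply_le (h : C(Torus, ℂ)) (g : LpTorus 2) :
    ‖mulOpC h g‖ ≤ ‖h‖ * ‖g‖ := by
  refine Lp.norm_le_mul_norm_of_ae_le_mul ?_
  filter_upwards [mulOpC_coeFn h g] with t ht
  rw [ht, norm_mul]
  exact mul_le_mul_of_nonneg_right (h.norm_coe_le_norm t) (norm_nonneg _)

lemma mulOpC_sub (h k : C(Torus, ℂ)) : mulOpC (h - k) = mulOpC h - mulOpC k := by
  simp only [mulOpC, mulOp, map_sub]

/-- A nonzero continuous function supported where `h` is almost maximal. -/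
lemma exists_test_function {h : C(Torus, ℂ)} {r : ℝ} (hr0 : 0 < r) (hr : r < ‖h‖) :
    ∃ g : C(Torus, ℂ), h * g ≠ 0 ∧ ∀ t, r * ‖g t‖ ≤ ‖h t * g t‖ := by
  obtain ⟨t₀, ht₀⟩ : ∃ t, r < ‖h t‖ := by
    by_contra! hcon
    exact absurd ((ContinuousMap.norm_le _ hr0.le).2 hcon) (not_le.2 hr)
  refine ⟨⟨fun t => ((max 0 (‖h t‖ - r) : ℝ) : ℂ), by fun_prop⟩, ?_, fun t => ?_⟩
  · intro h0
    have h1 := DFunLike.congr_fun h0 t₀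
    simp only [ContinuousMap.coe_mul, ContinuousMap.coe_mk, Pi.mul_apply, ContinuousMap.zero_apply,
      mul_eq_zero, Complex.ofReal_eq_zero] at h1
    rcases h1 with h1 | h1
    · rw [h1, norm_zero] at ht₀; linarith
    · rw [max_eq_right (by linarith)] at h1; linarith
  · rw [norm_mul]
    simp only [ContinuousMap.coe_mk, Complex.norm_real]
    rcases le_total (‖h t‖) r with hle | hle
    · rw [max_eq_left (by linarith)]; simp
    · exact mul_le_mul_of_nonneg_right hle (norm_nonneg _)

/-- For `r < ‖h‖`, a test function living where `|h| > r` gives `r‖g‖ ≤ ‖h g‖ ≤ K‖g‖`. -/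
lemma norm_le_of_norm_mulOpC_le {h : C(Torus, ℂ)} {K : ℝ} (hK : 0 ≤ K)
    (H : ∀ g, ‖mulOpC h g‖ ≤ K * ‖g‖) : ‖h‖ ≤ K := by
  refine le_of_forall_lt_imp_le_of_dense fun r hr => ?_
  rcases le_or_gt r 0 with hr0 | hr0
  · exact hr0.trans hK
  obtain ⟨g, hg0, hg⟩ := exists_test_function hr0 hr
  have hG0 : 0 < ‖ContinuousMap.toLp 2 torusMeasure ℂ g‖ := by
    rw [norm_pos_iff]
    intro h0
    rw [← map_zero (ContinuousMap.toLp 2 torusMeasure ℂ)] at h0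
    exact hg0 (by rw [ContinuousMap.toLp_injective torusMeasure h0, mul_zero])
  have h1 : ‖ContinuousMap.toLp 2 torusMeasure ℂ g‖
      ≤ r⁻¹ * ‖mulOpC h (ContinuousMap.toLp 2 torusMeasure ℂ g)‖ := by
    refine Lp.norm_le_mul_norm_of_ae_le_mul ?_
    filter_upwards [mulOpC_coeFn h (ContinuousMap.toLp 2 torusMeasure ℂ g),
      ContinuousMap.coeFn_toLp (p := 2) (𝕜 := ℂ) torusMeasure g] with t ht1 ht2
    rw [ht1, ht2, le_inv_mul_iff₀ hr0]
    exact hg t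
  rw [le_inv_mul_iff₀ hr0] at h1
  exact le_of_mul_le_mul_right (h1.trans (H _)) hG0

/-- The functional `g ↦ ∫ conj h * g` on `L₁`. -/
def pairingCLM (h : C(Torus, ℂ)) : LpTorus 1 →L[ℂ] ℂ :=
  (ContinuousLinearMap.mul ℂ ℂ).lpPairing torusMeasure ∞ 1
    (ContinuousMap.toLp ∞ torusMeasure ℂ (star h))

/-- The pairing is conjugate-linear in `g`; its conjugate is linear, as Banach–Steinhaus requires,
and has the same modulus. -/
lemma conj_pairingCLM_apply (h : C(Torus, ℂ)) (g : LpTorus 1) :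
    conj (pairingCLM h g) = pairing h g := by
  rw [pairingCLM, ContinuousLinearMap.lpPairing_eq_integral, ← integral_conj]
  refine integral_congr_ae ?_
  filter_upwards [ContinuousMap.coeFn_toLp (p := ∞) (𝕜 := ℂ) torusMeasure (star h)] with t ht
  rw [ht]
  simp

lemma norm_pairingCLM_apply (h : C(Torus, ℂ)) (g : LpTorus 1) :
    ‖pairingCLM h g‖ = ‖pairing h g‖ := by
  rw [← conj_pairingCLM_apply, RCLike.norm_conj]

lemma norm_pairing_le (h : C(Torus, ℂ)) (g : LpTorus 1) : ‖pairing h g‖ ≤ ‖h‖ * ‖g‖ := by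
  rw [L1.norm_eq_integral_norm, ← integral_const_mul]
  refine norm_integral_le_of_norm_le ((L1.integrable_coeFn g).norm.const_mul _)
    (.of_forall fun t => ?_)
  rw [norm_mul, RCLike.norm_conj]
  exact mul_le_mul_of_nonneg_right (h.norm_coe_le_norm t) (norm_nonneg _)

lemma norm_le_of_norm_pairing_le {h : C(Torus, ℂ)} {K : ℝ} (hK : 0 ≤ K)
    (H : ∀ g, ‖pairing h g‖ ≤ K * ‖g‖) : ‖h‖ ≤ K := by
  refine le_of_forall_lt_imp_le_of_dense fun r hr => ?_
  rcases le_or_gt r 0 with hr0 | hr0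
  · exact hr0.trans hK
  obtain ⟨g₀, hg0, hg⟩ := exists_test_function hr0 hr
  -- The factor `h` aligns the phases: `⟨h, q⟩ = ∫ |h|² |g₀| ≥ r ∫ |h| |g₀| = r‖q‖₁`.
  set q : C(Torus, ℂ) := h * ⟨fun t => (‖g₀ t‖ : ℂ), by fun_prop⟩ with hq
  have hqt : ∀ t, q t = h t * (‖g₀ t‖ : ℂ) := fun t => rfl
  have hq0 : q ≠ 0 := by
    intro h0
    refine hg0 (ContinuousMap.ext fun t => ?_)
    have := DFunLike.congr_fun h0 t
    rw [hqt] at this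
    simpa using this
  set G := ContinuousMap.toLp 1 torusMeasure ℂ q with hG
  have hG0 : 0 < ‖G‖ := by
    rw [norm_pos_iff]
    intro h0
    rw [hG, ← map_zero (ContinuousMap.toLp 1 torusMeasure ℂ)] at h0
    exact hq0 (ContinuousMap.toLp_injective torusMeasure h0)
  have hGae := ContinuousMap.coeFn_toLp (p := 1) (𝕜 := ℂ) torusMeasure q
  have hGn : ‖G‖ = ∫ t, ‖h t‖ * ‖g₀ t‖ ∂torusMeasure := by
    rw [L1.norm_eq_integral_norm]
    refine integral_congr_ae ?_
    filter_upwards [hGae] with t ht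
    rw [hG, ht, hqt, norm_mul, Complex.norm_real, norm_norm]
  have hpair : pairing h G = ((∫ t, ‖h t‖ ^ 2 * ‖g₀ t‖ ∂torusMeasure : ℝ) : ℂ) := by
    rw [pairing, ← integral_complex_ofReal]
    refine integral_congr_ae ?_
    filter_upwards [hGae] with t ht
    rw [hG, ht, hqt, map_mul, Complex.conj_ofReal, ← mul_assoc, Complex.mul_conj']
    push_cast
    rfl
  have h1 : r * ‖G‖ ≤ ‖pairing h G‖ := by
    rw [hpair, Complex.norm_real, hGn, ← integral_const_mul]
    refine le_trans ?_ (le_abs_self _)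
    refine integral_mono (integrable_of_continuous (by fun_prop))
      (integrable_of_continuous (by fun_prop)) fun t => ?_
    have := hg t
    rw [norm_mul] at this
    have := mul_le_mul_of_nonneg_left this (norm_nonneg (h t))
    simp only
    nlinarith
  exact le_of_mul_le_mul_right (h1.trans (H _)) hG0

/-! ### Uniform boundedness -/

/-- Banach–Steinhaus applies to `A i / n i`. Where `n i = 0` the inverse is 0 by convention, and the
hypothesis forces `A i = 0`. -/
lemma exists_bound_of_pointwise {𝕜 E F ι : Type*} [RCLike 𝕜] [NormedAddCommGroup E]
    [NormedSpace 𝕜 E] [CompleteSpace E] [NormedAddCommGroup F] [NormedSpace 𝕜 F]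
    (A : ι → E →L[𝕜] F) (n : ι → ℝ) (hn : ∀ i, 0 ≤ n i)
    (h : ∀ x, ∃ C, ∀ i, ‖A i x‖ ≤ C * n i) :
    ∃ C, 0 ≤ C ∧ ∀ i x, ‖A i x‖ ≤ C * n i * ‖x‖ := by
  obtain ⟨C, hC⟩ := banach_steinhaus (g := fun i => ((n i : 𝕜)⁻¹) • A i) (fun x => by
    obtain ⟨C, hC⟩ := h x
    refine ⟨|C|, fun i => ?_⟩
    rw [smul_apply, norm_smul, norm_inv, RCLike.norm_ofReal,
      abs_of_nonneg (hn i)]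
    rcases (hn i).eq_or_lt with h0 | h0
    · rw [← h0]; simp
    · rw [inv_mul_le_iff₀ h0, mul_comm]
      exact (hC i).trans (mul_le_mul_of_nonneg_right (le_abs_self C) h0.le))
  refine ⟨|C|, abs_nonneg C, fun i x => ?_⟩
  rcases (hn i).eq_or_lt with h0 | h0
  · obtain ⟨C', hC'⟩ := h x
    have := hC' i
    rw [← h0, mul_zero] at this
    rw [← h0]
    simpa using this
  · have h1 := (((n i : 𝕜)⁻¹) • A i).le_of_opNorm_le ((hC i).trans (le_abs_self C)) x
    rw [smul_apply, norm_smul, norm_inv, RCLike.norm_ofReal,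
      abs_of_nonneg (hn i), inv_mul_le_iff₀ h0] at h1
    linarith

/-- Banach–Steinhaus is used twice: for the vectors `A N x` as functionals on the dual, then for the
operators `A N`. -/
lemma exists_bound_of_tendstoWOT {A : ℕ → LpTorus 2 →L[ℂ] LpTorus 2}
    {B : LpTorus 2 →L[ℂ] LpTorus 2} (h : TendstoWOT A B) : ∃ C, ∀ N, ‖A N‖ ≤ C := by
  rw [TendstoWOT, ContinuousLinearMapWOT.tendsto_iff_forall_dual_apply_tendsto] at h
  refine banach_steinhaus fun x => ?_
  obtain ⟨C, hC⟩ := banach_steinhaus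
    (g := fun N => NormedSpace.inclusionInDoubleDual ℂ (LpTorus 2) (A N x)) (fun y => by
      obtain ⟨C, hC⟩ := (Metric.isBounded_range_of_tendsto _ (h x y)).exists_norm_le
      exact ⟨C, fun N => hC _ ⟨N, rfl⟩⟩)
  refine ⟨C, fun N => ?_⟩
  have := (NormedSpace.inclusionInDoubleDualLi ℂ (E := LpTorus 2)).norm_map (A N x)
  rw [← this]
  exact hC N

/-! ### Uniform bounds for trigonometric polynomials -/

/-- Every trigonometric polynomial `T` has a rearrangement all of whose partial sums are bounded
by `K * ‖T‖`. -/
def HasBoundedRearrangements (K : ℝ≥0) : Prop :=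
  ∀ T ∈ trigPoly, ∃ τ : Equiv.Perm ℤ, ∀ N, ‖partialSum τ N T‖ ≤ K * ‖T‖

/-- The infimum need not be attained; enlarging `C` leaves room to choose `τ` when `T ≠ 0`. -/
lemma hasBoundedRearrangements_of_iInf_le {C : ℝ≥0}
    (h : ∀ T ∈ trigPoly,
      (⨅ σ : Equiv.Perm ℤ, ⨆ N : ℕ, ‖partialSum σ N T‖ₑ) ≤ (C : ℝ≥0∞) * ‖T‖ₑ) :
    HasBoundedRearrangements (C + 1) := by
  intro T hT
  rcases eq_or_ne T 0 with rfl | hT0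
  · exact ⟨1, fun N => by rw [partialSum_zero, norm_zero, mul_zero]⟩
  · have hlt : (C : ℝ≥0∞) * ‖T‖ₑ < ((C + 1 : ℝ≥0) : ℝ≥0∞) * ‖T‖ₑ := by
      have : 0 < ‖T‖₊ := nnnorm_pos.2 hT0
      rw [enorm_eq_nnnorm, ← ENNReal.coe_mul, ← ENNReal.coe_mul, ENNReal.coe_lt_coe]
      exact mul_lt_mul_of_pos_right (lt_add_one C) this
    obtain ⟨τ, hτ⟩ := iInf_lt_iff.1 ((h T hT).trans_lt hlt)
    exact ⟨τ, fun N => enorm_le_coe_mul_enorm_iff.1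
      ((le_iSup (fun N => ‖partialSum τ N T‖ₑ) N).trans hτ.le)⟩

lemma HasBoundedRearrangements.iInf_le {K : ℝ≥0} (h : HasBoundedRearrangements K) :
    ∃ C : ℝ≥0, 0 < C ∧ ∀ T ∈ trigPoly,
      (⨅ σ : Equiv.Perm ℤ, ⨆ N : ℕ, ‖partialSum σ N T‖ₑ) ≤ (C : ℝ≥0∞) * ‖T‖ₑ := by
  refine ⟨K + 1, by positivity, fun T hT => ?_⟩
  obtain ⟨τ, hτ⟩ := h T hT
  refine iInf_le_of_le τ (iSup_le fun N => enorm_le_coe_mul_enorm_iff.2 ((hτ N).trans ?_))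
  push_cast
  nlinarith [norm_nonneg T]

/-- Bounds that are only pointwise in `g` for operators controlling the partial sums are
uniform. -/
lemma exists_hasBoundedRearrangements {E F : Type*} [NormedAddCommGroup E] [NormedSpace ℂ E]
    [CompleteSpace E] [NormedAddCommGroup F] [NormedSpace ℂ F]
    (Λ : C(Torus, ℂ) → E →L[ℂ] F)
    (hΛ : ∀ (h : C(Torus, ℂ)) (K : ℝ), 0 ≤ K → (∀ g, ‖Λ h g‖ ≤ K * ‖g‖) → ‖h‖ ≤ K)
    (C : E → ℝ≥0) (σ : trigPoly → Equiv.Perm ℤ)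
    (h : ∀ (g : E) (T : trigPoly) (N : ℕ),
      ‖Λ (partialSum (σ T) N (T : C(Torus, ℂ))) g‖ ≤ C g * ‖(T : C(Torus, ℂ))‖) :
    ∃ K, HasBoundedRearrangements K := by
  -- The pairs `(T, N)` index one family of operators because `σ` depends on `T` alone and not on
  -- `g`.
  obtain ⟨K, hK0, hK⟩ := exists_bound_of_pointwise
    (fun i : trigPoly × ℕ => Λ (partialSum (σ i.1) i.2 (i.1 : C(Torus, ℂ))))
    (fun i => ‖(i.1 : C(Torus, ℂ))‖) (fun i => norm_nonneg _)
    (fun g => ⟨C g, fun i => h g i.1 i.2⟩)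
  exact ⟨⟨K, hK0⟩, fun T hT => ⟨σ ⟨T, hT⟩, fun N =>
    hΛ _ _ (mul_nonneg hK0 (norm_nonneg T)) (hK (⟨T, hT⟩, N))⟩⟩

end

end RearrangedFourier

/-! ### The equivalences -/

open RearrangedFourier in
theorem theorem3 :
    List.TFAE [
      -- (i) uniform convergence of some rearrangement
      ∀ f : C(RearrangedFourier.Torus, ℂ), ∃ σ : Equiv.Perm ℤ,
        Tendsto (fun N : ℕ => ‖RearrangedFourier.partialSum σ N f - f‖) atTop (𝓝 0),
      -- (ii) strong operator convergence of some rearrangement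
      ∀ f : C(RearrangedFourier.Torus, ℂ), ∃ σ : Equiv.Perm ℤ,
        RearrangedFourier.TendstoSOT
          (fun N : ℕ => RearrangedFourier.mulOpC (RearrangedFourier.partialSum σ N f))
          (RearrangedFourier.mulOpC f),
      -- (iii) weak operator convergence of some rearrangement
      ∀ f : C(RearrangedFourier.Torus, ℂ), ∃ σ : Equiv.Perm ℤ,
        RearrangedFourier.TendstoWOT
          (fun N : ℕ => RearrangedFourier.mulOpC (RearrangedFourier.partialSum σ N f))
          (RearrangedFourier.mulOpC f),
      -- (iv) bounded partial sums
      ∀ f : C(RearrangedFourier.Torus, ℂ),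
        (⨅ σ : Equiv.Perm ℤ, ⨆ N : ℕ, ‖RearrangedFourier.partialSum σ N f‖ₑ) < ∞,
      -- (v) a uniform bound for trigonometric polynomials
      ∃ C : ℝ≥0, 0 < C ∧ ∀ T ∈ RearrangedFourier.trigPoly,
        (⨅ σ : Equiv.Perm ℤ, ⨆ N : ℕ, ‖RearrangedFourier.partialSum σ N T‖ₑ)
          ≤ (C : ℝ≥0∞) * ‖T‖ₑ,
      -- (vi) weighted L₂ bounds, the rearrangement depending on the polynomial only
      ∃ (C : RearrangedFourier.LpTorus 2 → ℝ≥0)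
        (σ : RearrangedFourier.trigPoly → Equiv.Perm ℤ),
        ∀ (g : RearrangedFourier.LpTorus 2) (T : RearrangedFourier.trigPoly),
          (⨆ N : ℕ, ‖RearrangedFourier.mulOpC
              (RearrangedFourier.partialSum (σ T) N (T : C(RearrangedFourier.Torus, ℂ))) g‖ₑ)
            ≤ (C g : ℝ≥0∞) * ‖(T : C(RearrangedFourier.Torus, ℂ))‖ₑ,
      -- (vii) bounds for the pairing with L₁, the rearrangement depending on the polynomial only
      ∃ (C : RearrangedFourier.LpTorus 1 → ℝ≥0)
        (σ : RearrangedFourier.trigPoly → Equiv.Perm ℤ),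
        ∀ (g : RearrangedFourier.LpTorus 1) (T : RearrangedFourier.trigPoly),
          (⨆ N : ℕ, ‖RearrangedFourier.pairing
              (RearrangedFourier.partialSum (σ T) N (T : C(RearrangedFourier.Torus, ℂ))) g‖ₑ)
            ≤ (C g : ℝ≥0∞) * ‖(T : C(RearrangedFourier.Torus, ℂ))‖ₑ] := by
  tfae_have 1 → 2 := by
    intro h f
    obtain ⟨σ, hσ⟩ := h f
    refine ⟨σ, ?_⟩
    rw [TendstoSOT, PointwiseConvergenceCLM.tendsto_iff_forall_tendsto]
    intro g
    refine tendsto_iff_norm_sub_tendsto_zero.2 (squeeze_zero (fun N => norm_nonneg _)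
      (fun N => ?_) (by simpa using hσ.mul_const ‖g‖))
    have := norm_mulOpC_apply_le (partialSum σ N f - f) g
    rw [mulOpC_sub] at this
    exact this
  tfae_have 2 → 3 := by
    intro h f
    obtain ⟨σ, hσ⟩ := h f
    refine ⟨σ, ?_⟩
    rw [TendstoSOT, PointwiseConvergenceCLM.tendsto_iff_forall_tendsto] at hσ
    rw [TendstoWOT, ContinuousLinearMapWOT.tendsto_iff_forall_dual_apply_tendsto]
    exact fun g y => (y.continuous.tendsto _).comp (hσ g)
  tfae_have 3 → 4 := by
    intro h f
    obtain ⟨σ, hσ⟩ := h f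
    obtain ⟨C, hC⟩ := exists_bound_of_tendstoWOT hσ
    have hC0 : 0 ≤ C := (norm_nonneg _).trans (hC 0)
    refine (iInf_le_of_le σ (iSup_le fun N => ?_)).trans_lt (ENNReal.ofReal_lt_top (r := C))
    rw [← ofReal_norm]
    exact ENNReal.ofReal_le_ofReal
      (norm_le_of_norm_mulOpC_le hC0 fun g => (mulOpC _).le_of_opNorm_le (hC N) g)
  tfae_have 4 → 5 := exists_uniform_bound_of_pointwise
  tfae_have 5 → 1 := by
    rintro ⟨C, -, hC⟩ f
    exact exists_tendsto_partialSum (C + 1).2 (hasBoundedRearrangements_of_iInf_le hC) f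
  tfae_have 5 → 6 := by
    rintro ⟨C, -, hC⟩
    choose σ hσ using hasBoundedRearrangements_of_iInf_le hC
    refine ⟨fun g => (C + 1) * ‖g‖₊, fun T => σ T T.2, fun g T => iSup_le fun N =>
      enorm_le_coe_mul_enorm_iff.2 ?_⟩
    calc _ ≤ ‖partialSum (σ T T.2) N (T : C(Torus, ℂ))‖ * ‖g‖ := norm_mulOpC_apply_le _ g
      _ ≤ ((C + 1 : ℝ≥0) * ‖(T : C(Torus, ℂ))‖) * ‖g‖ := by gcongr; exact hσ T T.2 N
      _ = _ := by push_cast; ring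
  tfae_have 6 → 5 := by
    rintro ⟨C, σ, h⟩
    obtain ⟨K, hK⟩ := exists_hasBoundedRearrangements mulOpC
      (fun h K hK H => norm_le_of_norm_mulOpC_le hK H) C σ
      (fun g T N => enorm_le_coe_mul_enorm_iff.1 ((le_iSup _ N).trans (h g T)))
    exact hK.iInf_le
  tfae_have 5 → 7 := by
    rintro ⟨C, -, hC⟩
    choose σ hσ using hasBoundedRearrangements_of_iInf_le hC
    refine ⟨fun g => (C + 1) * ‖g‖₊, fun T => σ T T.2, fun g T => iSup_le fun N =>
      enorm_le_coe_mul_enorm_iff.2 ?_⟩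
    calc _ ≤ ‖partialSum (σ T T.2) N (T : C(Torus, ℂ))‖ * ‖g‖ := norm_pairing_le _ g
      _ ≤ ((C + 1 : ℝ≥0) * ‖(T : C(Torus, ℂ))‖) * ‖g‖ := by gcongr; exact hσ T T.2 N
      _ = _ := by push_cast; ring
  tfae_have 7 → 5 := by
    rintro ⟨C, σ, h⟩
    obtain ⟨K, hK⟩ := exists_hasBoundedRearrangements pairingCLM
      (fun h K hK H => norm_le_of_norm_pairing_le hK fun g => by
        rw [← norm_pairingCLM_apply]; exact H g) C σ
      (fun g T N => by
        rw [norm_pairingCLM_apply]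
        exact enorm_le_coe_mul_enorm_iff.1 ((le_iSup _ N).trans (h g T)))
    exact hK.iInf_le
  tfae_finish
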